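/- Let $G$ be a connected (finite-dimensional, real) unimodular Lie group with Lie algebra $\mathfrak g$ and Haar measure $\mu$. Let $P\subseteq G$ be a Lie semigroup, i.e. a closed subsemigroup containing the identity such that the semigroup generated by $\exp(L(P))$ is dense in $P$, where $L(P)=\{X\in\mathfrak g:\exp(tX)\in P\text{ for all }t\ge 0\}$. Assume that the interior $\Omega$ of $P$ is dense in $P$ and that $PP^{-1}=P^{-1}P=G$. Let $A$ be a $P$-space, i.e. a non-empty proper closed subset of $G$ with $PA\subseteq A$. Then the following are equivalent: 1. $\mu(A\setminus xA)<\infty$ for every $x\in P$; 2. $\mu(A\setminus xA)<\infty$ for every $x\in\Omega$; 3. the boundary $\partial A$ is compact. Let $V=V^{(A,1)}$ be the isometric representation of $P$ on $L^2(A,\mu)$ given by $V_xf(y)=f(x^{-1}y)$ if $x^{-1}y\in A$ and $V_xf(y)=0$ otherwise. An additive cocycle of $V$ is a continuous map $\xi:P\to L^2(A,\mu)$ with $\xi_x\in\ker V_x^*$ and $\xi_{xy}=\xi_x+V_x\xi_y$ for all $x,y\in P$. Then $V$ has a non-zero additive cocycle if and only if $\partial A$ is compact. Let $\alpha=\{\alpha_x\}_{x\in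 P}$ be the CCR flow of $V$, i.e. the semigroup of unital normal $*$-endomorphisms of $B(\Gamma(L^2(A,\mu)))$, $\Gamma$ denoting the symmetric Fock space, with $\alpha_x(W(\xi))=W(V_x\xi)$ for all Weyl operators $W(\xi)$. A unit of $\alpha$ is a strongly continuous family $u=\{u_x\}_{x\in P}$ of non-zero bounded operators with $u_{xy}=u_xu_y$ and $\alpha_x(T)u_x=u_xT$ for all $x,y\in P$ and all bounded operators $T$. Then $\alpha$ has more than one unit up to characters, i.e. it has two units $u,v$ for which there is no continuous homomorphism $\chi:G\to\mathbb C^\times$ with $v_x=\chi(x)u_x$ for all $x\in P$, if and only if $\partial A$ is compact. -/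

import Mathlib

open MeasureTheory
open scoped InnerProductSpace ComplexOrder Manifold ContDiff Pointwise Topology

namespace PSpaceCCR

noncomputable section

section LieSemigroups

variable (E : Type*) [NormedAddCommGroup E] [NormedSpace ℝ E]
  {G : Type*} [Group G] [TopologicalSpace G] [ChartedSpace E G]

/-- `γ` is the one-parameter subgroup `t ↦ exp (t X)` of `G`: a smooth homomorphism from `ℝ` to `G`
whose derivative at `0` is `X`. -/
structure IsOneParam (X : GroupLieAlgebra 𝓘(ℝ, E) G) (γ : ℝ → G) : Prop where
  contMDiff : ContMDiff 𝓘(ℝ, ℝ) 𝓘(ℝ, E) ∞ γ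
  map_zero : γ 0 = 1
  map_add : ∀ s t, γ (s + t) = γ s * γ t
  deriv_zero : HasMFDerivAt 𝓘(ℝ, ℝ) 𝓘(ℝ, E) γ 0 ((1 : ℝ →L[ℝ] ℝ).smulRight (X : E))

open Classical in
/-- `expCurve E X t` is `exp (t X)`. (In a Lie group there is exactly one one-parameter subgroup
with a given derivative at `0`; the default value is never used.) -/
def expCurve (X : GroupLieAlgebra 𝓘(ℝ, E) G) : ℝ → G :=
  if h : ∃ γ, IsOneParam E X γ then h.choose else fun _ => 1

/-- The Lie wedge `L(P) = {X : exp (t X) ∈ P for all t ≥ 0}`. -/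
def lieWedge (P : Submonoid G) : Set (GroupLieAlgebra 𝓘(ℝ, E) G) :=
  {X | ∀ t : ℝ, 0 ≤ t → expCurve E X t ∈ P}

/-- `P` is a Lie semigroup: a closed subsemigroup of `G` containing the identity, in which the
semigroup generated by `exp (L(P))` is dense. -/
structure IsLieSemigroup (P : Submonoid G) : Prop where
  isClosed : IsClosed (P : Set G)
  dense : (P : Set G) ⊆
    closure (Subsemigroup.closure ((fun X => expCurve E X 1) '' lieWedge E P) : Set G)

end LieSemigroups

section PSpaces

variable {G : Type*} [Group G]

/-- `P P⁻¹ = P⁻¹ P = G`. -/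
def IsOre (P : Submonoid G) : Prop :=
  (P : Set G) * (P : Set G)⁻¹ = Set.univ ∧ (P : Set G)⁻¹ * (P : Set G) = Set.univ

open Classical in
/-- The function `y ↦ f (x⁻¹ y)` if `x⁻¹ y ∈ A`, and `0` otherwise. -/
def shiftFun (A : Set G) (x : G) (f : G → ℂ) (y : G) : ℂ :=
  if x⁻¹ * y ∈ A then f (x⁻¹ * y) else 0

theorem shiftFun_eq (A : Set G) (x : G) (f : G → ℂ) :
    shiftFun A x f = (A.indicator f) ∘ (fun y => x⁻¹ * y) := by
  funext y
  simp [shiftFun, Set.indicator]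

variable [TopologicalSpace G]

/-- `A` is a `P`-space: a non-empty proper closed subset of `G` with `P A ⊆ A`. -/
structure IsPSpace (P : Submonoid G) (A : Set G) : Prop where
  isClosed : IsClosed A
  nonempty : A.Nonempty
  ne_univ : A ≠ Set.univ
  mul_mem : ∀ a ∈ P, ∀ y ∈ A, a * y ∈ A

variable [IsTopologicalGroup G] [MeasurableSpace G] [BorelSpace G]
  {μ : Measure G} [μ.IsMulLeftInvariant] {A : Set G}

theorem shiftFun_congr_ae (hA : MeasurableSet A) {f g : G → ℂ} (x : G) (h : f =ᵐ[μ.restrict A] g) :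
    shiftFun A x f =ᵐ[μ.restrict A] shiftFun A x g := by
  rw [shiftFun_eq, shiftFun_eq]
  refine ae_restrict_of_ae ?_
  exact (measurePreserving_mul_left μ x⁻¹).quasiMeasurePreserving.ae_eq_comp
    ((ae_eq_restrict_iff_indicator_ae_eq hA).1 h)

theorem memLp_shiftFun (hA : MeasurableSet A) (x : G) {f : G → ℂ} (hf : MemLp f 2 (μ.restrict A)) :
    MemLp (shiftFun A x f) 2 (μ.restrict A) := by
  rw [shiftFun_eq]
  exact (((memLp_indicator_iff_restrict hA).2 hf).comp_measurePreserving
    (measurePreserving_mul_left μ x⁻¹)).restrict A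

theorem eLpNorm_shiftFun (hA : MeasurableSet A) {x : G} (hx : ∀ y ∈ A, x * y ∈ A) {f : G → ℂ}
    (hf : MemLp f 2 (μ.restrict A)) :
    eLpNorm (shiftFun A x f) 2 (μ.restrict A) = eLpNorm f 2 (μ.restrict A) := by
  have h1 : A.indicator (shiftFun A x f) = shiftFun A x f := by
    refine Set.indicator_eq_self.2 fun y hy => ?_
    by_contra hyA
    refine hy ?_
    have : x⁻¹ * y ∉ A := fun h => hyA (by simpa using hx _ h)
    simp [shiftFun, this]
  rw [← eLpNorm_indicator_eq_eLpNorm_restrict hA, h1, shiftFun_eq,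
    eLpNorm_comp_measurePreserving ((memLp_indicator_iff_restrict hA).2 hf).1
      (measurePreserving_mul_left μ x⁻¹), eLpNorm_indicator_eq_eLpNorm_restrict hA]

/-- For `x A ⊆ A`, the isometry of `L²(A, μ)` which maps `f` to the function with value `f (x⁻¹ y)`
at `y` if `x⁻¹ y ∈ A`, and `0` otherwise. -/
def shiftIsometry (hA : MeasurableSet A) {x : G} (hx : ∀ y ∈ A, x * y ∈ A) :
    Lp ℂ 2 (μ.restrict A) →ₗᵢ[ℂ] Lp ℂ 2 (μ.restrict A) where
  toFun f := (memLp_shiftFun hA x (Lp.memLp f)).toLp _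
  map_add' f g := by
    rw [← MemLp.toLp_add]
    refine MemLp.toLp_congr _ _ ((shiftFun_congr_ae hA x (Lp.coeFn_add f g)).trans ?_)
    refine Filter.EventuallyEq.of_eq (funext fun y => ?_)
    simp only [shiftFun, Pi.add_apply]
    split_ifs <;> simp
  map_smul' c f := by
    rw [RingHom.id_apply, ← MemLp.toLp_const_smul]
    refine MemLp.toLp_congr _ _ ((shiftFun_congr_ae hA x (Lp.coeFn_smul c f)).trans ?_)
    refine Filter.EventuallyEq.of_eq (funext fun y => ?_)
    simp only [shiftFun, Pi.smul_apply]
    split_ifs <;> simp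
  norm_map' f := by
    change ‖(memLp_shiftFun hA x (Lp.memLp f)).toLp _‖ = _
    rw [Lp.norm_toLp, eLpNorm_shiftFun hA hx (Lp.memLp f), Lp.norm_def]

theorem shiftIsometry_ae (hA : MeasurableSet A) {x : G} (hx : ∀ y ∈ A, x * y ∈ A)
    (f : Lp ℂ 2 (μ.restrict A)) : shiftIsometry hA hx f =ᵐ[μ.restrict A] shiftFun A x f :=
  MemLp.coeFn_toLp (memLp_shiftFun hA x (Lp.memLp f))

variable (μ) in
/-- The isometric representation `V^{(A,1)}` of `P` on `L²(A, μ)` associated to a `P`-space `A`: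
`V_x f (y) = f (x⁻¹ y)` if `x⁻¹ y ∈ A`, and `V_x f (y) = 0` otherwise. -/
def pSpaceRep {P : Submonoid G} (hA : IsPSpace P A) :
    P →* (Lp ℂ 2 (μ.restrict A) →ₗᵢ[ℂ] Lp ℂ 2 (μ.restrict A)) where
  toFun x := shiftIsometry hA.isClosed.measurableSet (hA.mul_mem x x.2)
  map_one' := by
    refine LinearIsometry.ext fun f => Lp.ext ((shiftIsometry_ae _ _ f).trans ?_)
    filter_upwards [ae_restrict_mem hA.isClosed.measurableSet] with y hy
    simp [shiftFun, hy]
  map_mul' x z := by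
    refine LinearIsometry.ext fun f => Lp.ext ((shiftIsometry_ae _ _ f).trans ?_)
    have hm := hA.isClosed.measurableSet
    refine Filter.EventuallyEq.symm ((shiftIsometry_ae hm (hA.mul_mem x x.2) _).trans
      ((shiftFun_congr_ae hm _ (shiftIsometry_ae hm (hA.mul_mem z z.2) f)).trans ?_))
    refine Filter.EventuallyEq.of_eq (funext fun y => ?_)
    have h1 : (x * z : G)⁻¹ * y = (z : G)⁻¹ * ((x : G)⁻¹ * y) := by group
    simp only [shiftFun, Submonoid.coe_mul]
    by_cases h : (z : G)⁻¹ * ((x : G)⁻¹ * y) ∈ A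
    · have h2 : (x : G)⁻¹ * y ∈ A := by simpa using hA.mul_mem z z.2 _ h
      have h3 : (x * z : G)⁻¹ * y ∈ A := by rw [h1]; exact h
      rw [if_pos h2, if_pos h, if_pos h3, h1]
    · have h3 : (x * z : G)⁻¹ * y ∉ A := by rw [h1]; exact h
      rw [if_neg h, if_neg h3, ite_self]

end PSpaces

section Fock

variable {H : Type*} [NormedAddCommGroup H] [InnerProductSpace ℂ H]

theorem inner_self_eq_ofReal {F : Type*} [NormedAddCommGroup F] [InnerProductSpace ℂ F] (x : F) :
    ⟪x, x⟫_ℂ = ((‖x‖ ^ 2 : ℝ) : ℂ) := by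
  rw [inner_self_eq_norm_sq_to_K]
  simp

theorem sum_gram {F : Type*} [NormedAddCommGroup F] [InnerProductSpace ℂ F] {X : Type*}
    (v : X → F) (c : X →₀ ℂ) :
    (c.sum fun i ci => c.sum fun j cj => star ci * ⟪v i, v j⟫_ℂ * cj) =
      ⟪Finsupp.linearCombination ℂ v c, Finsupp.linearCombination ℂ v c⟫_ℂ := by
  simp only [Finsupp.linearCombination_apply, Finsupp.sum, sum_inner, inner_sum,
    inner_smul_left, inner_smul_right, RCLike.star_def, Finset.mul_sum]
  rw [Finset.sum_comm]
  exact Finset.sum_congr rfl fun i _ => Finset.sum_congr rfl fun j _ => by ring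

theorem posSemidef_inner {F : Type*} [NormedAddCommGroup F] [InnerProductSpace ℂ F] {X : Type*}
    (v : X → F) : (Matrix.of fun i j => ⟪v i, v j⟫_ℂ).PosSemidef := by
  refine ⟨Matrix.IsHermitian.ext fun i j => by simp, fun c => ?_⟩
  refine le_of_le_of_eq ?_ (sum_gram v c).symm
  rw [inner_self_eq_norm_sq_to_K]
  simp

theorem posSemidef_exp {X : Type*} {K : Matrix X X ℂ} (hK : K.PosSemidef) :
    (Matrix.of fun i j => Complex.exp (K i j)).PosSemidef := by
  have hpow : ∀ n : ℕ, (Matrix.of fun i j => (K i j) ^ n).PosSemidef := by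
    intro n
    induction n with
    | zero =>
      convert! posSemidef_inner (F := ℂ) (fun _ : X => (1 : ℂ)) using 1
      ext i j; simp
    | succ n ih =>
      convert! ih.hadamard hK using 1
  refine ⟨?_, fun x => ?_⟩
  · ext i j
    have := congrFun (congrFun hK.isHermitian i) j
    simp only [Matrix.conjTranspose_apply, Matrix.of_apply, RCLike.star_def] at this ⊢
    rw [← Complex.exp_conj, this]
  · have h1 : HasSum (fun n : ℕ => ((n.factorial : ℂ)⁻¹) *
        (x.sum fun i xi => x.sum fun j xj => star xi * (K i j) ^ n * xj))
        (x.sum fun i xi => x.sum fun j xj => star xi * Complex.exp (K i j) * xj) := by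
      simp only [Finsupp.sum, Finset.mul_sum]
      refine hasSum_sum fun i _ => hasSum_sum fun j _ => ?_
      have h2 : HasSum (fun n : ℕ => (K i j) ^ n / (n.factorial : ℂ)) (Complex.exp (K i j)) := by
        rw [Complex.exp_eq_exp_ℂ]
        exact NormedSpace.expSeries_div_hasSum_exp (K i j)
      convert! (h2.mul_left (star (x i))).mul_right (x j) using 2
      ring
    refine h1.nonneg fun n => mul_nonneg ?_ ((hpow n).2 x)
    rw [← Complex.ofReal_natCast, ← Complex.ofReal_inv]
    exact Complex.zero_le_real.2 (by positivity)

variable (H) in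
/-- The exponential kernel `(ξ, η) ↦ exp ⟪ξ, η⟫` on `H`, with values in the operators of `ℂ`. -/
def expKernel : Matrix H H (ℂ →L[ℂ] ℂ) :=
  Matrix.of fun ξ η => Complex.exp ⟪ξ, η⟫_ℂ • (1 : ℂ →L[ℂ] ℂ)

instance : Fact (expKernel H).PosSemidef := by
  have hP := posSemidef_exp (posSemidef_inner (fun ξ : H => ξ))
  have hH : (expKernel H).IsHermitian := by
    refine Matrix.IsHermitian.ext fun ξ η => ?_
    ext
    simp [expKernel, ← Complex.exp_conj]
  have hT : (expKernel H).PosSemidef ↔ (expKernel H).IsHermitian ∧ ∀ c : H →₀ ℂ,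
      0 ≤ RCLike.re (c.sum fun x w => c.sum fun x' w' => ⟪expKernel H x' x w, w'⟫_ℂ) :=
    (RKHS.posSemidef_tfae (𝕜 := ℂ) (K := expKernel H)).out 0 2
  refine ⟨hT.2 ⟨hH, fun c => ?_⟩⟩
  have h := (RCLike.nonneg_iff.1 (hP.2 c)).1
  convert! h using 6
  simp only [expKernel, Matrix.of_apply, FunLike.coe_smul, Pi.smul_apply,
    one_apply_eq_self, RCLike.inner_apply, smul_eq_mul, map_mul, ← Complex.exp_conj,
    inner_conj_symm, RCLike.star_def]
  funext η w
  ring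

variable (H) in
/-- The symmetric Fock space `Γ(H)`, realised as the Hilbert space spanned by the exponential
vectors `e(ξ)`, `ξ ∈ H`, with `⟪e(ξ), e(η)⟫ = exp ⟪ξ, η⟫`, that is, as the reproducing kernel Hilbert
space of the exponential kernel. It is the orthogonal sum of the symmetric tensor powers of `H`, with
`e(ξ) = ∑ ξ^{⊗n} / √(n!)`. Inner products are linear in the second variable. -/
def Fock : Type _ := RKHS.OfKernel (expKernel H)

instance : NormedAddCommGroup (Fock H) :=
  inferInstanceAs (NormedAddCommGroup (RKHS.OfKernel (expKernel H)))
instance : InnerProductSpace ℂ (Fock H) :=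
  inferInstanceAs (InnerProductSpace ℂ (RKHS.OfKernel (expKernel H)))
instance : CompleteSpace (Fock H) :=
  inferInstanceAs (CompleteSpace (RKHS.OfKernel (expKernel H)))

/-- The exponential vector `e(ξ)`. -/
def expVec (ξ : H) : Fock H := RKHS.kerFun (RKHS.OfKernel (expKernel H)) ξ 1

theorem inner_expVec (ξ η : H) : ⟪expVec ξ, expVec η⟫_ℂ = Complex.exp ⟪ξ, η⟫_ℂ := by
  have h := RKHS.kernel_inner (RKHS.OfKernel (expKernel H)) η ξ (1 : ℂ) (1 : ℂ)
  rw [RKHS.OfKernel.kernel_ofKernel] at h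
  refine Eq.trans h.symm ?_
  simp [expKernel, ← Complex.exp_conj]

theorem expVec_dense : DenseRange (Finsupp.linearCombination ℂ (expVec : H → Fock H)) := by
  have h : (Submodule.span ℂ {x : Fock H | ∃ (ξ : H) (z : ℂ),
      RKHS.kerFun (RKHS.OfKernel (expKernel H)) ξ z = x}).topologicalClosure = ⊤ :=
    RKHS.kerFun_dense (RKHS.OfKernel (expKernel H))
  have h2 : (LinearMap.range (Finsupp.linearCombination ℂ (expVec : H → Fock H))).topologicalClosure
      = ⊤ := by
    rw [Finsupp.range_linearCombination, eq_top_iff, ← h]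
    refine Submodule.topologicalClosure_mono (Submodule.span_le.2 ?_)
    rintro _ ⟨ξ, z, rfl⟩
    have : RKHS.kerFun (RKHS.OfKernel (expKernel H)) ξ z = z • expVec ξ := by
      have h1 := (RKHS.kerFun (RKHS.OfKernel (expKernel H)) ξ).map_smul z 1
      rw [smul_eq_mul, mul_one] at h1
      exact h1
    rw [this]
    exact Submodule.smul_mem _ _ (Submodule.subset_span ⟨ξ, rfl⟩)
  have h3 := congrArg (fun S : Submodule ℂ (Fock H) => (S : Set (Fock H))) h2
  rw [DenseRange, dense_iff_closure_eq]
  rw [← LinearMap.coe_range]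
  exact h3

theorem ext_expVec {F : Type*} [NormedAddCommGroup F] [NormedSpace ℂ F] {S T : Fock H →L[ℂ] F}
    (h : ∀ ξ, S (expVec ξ) = T (expVec ξ)) : S = T := by
  refine ContinuousLinearMap.ext fun f => ?_
  refine congrFun (expVec_dense.equalizer S.continuous T.continuous (funext fun c => ?_)) f
  simp [Finsupp.linearCombination_apply, Finsupp.sum, h]

/-- The bounded operator on `Γ(H)` with `e(η) ↦ g η` for all `η` (used only where there is one). -/
def opOfExp (g : H → Fock H) : Fock H →L[ℂ] Fock H :=
  (Finsupp.linearCombination ℂ g).extendOfNorm (Finsupp.linearCombination ℂ expVec)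

theorem opOfExp_apply (g : H → Fock H) (C : ℝ) (hC : 0 ≤ C)
    (h : (Matrix.of fun ξ η => (C : ℂ) ^ 2 * Complex.exp ⟪ξ, η⟫_ℂ - ⟪g ξ, g η⟫_ℂ).PosSemidef)
    (ξ : H) : opOfExp g (expVec ξ) = g ξ := by
  have hb : ∀ c : H →₀ ℂ, ‖Finsupp.linearCombination ℂ g c‖ ≤
      C * ‖Finsupp.linearCombination ℂ expVec c‖ := by
    intro c
    have h1 : (0 : ℂ) ≤ (C : ℂ) ^ 2 * ⟪Finsupp.linearCombination ℂ expVec c,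
        Finsupp.linearCombination ℂ expVec c⟫_ℂ
        - ⟪Finsupp.linearCombination ℂ g c, Finsupp.linearCombination ℂ g c⟫_ℂ := by
      refine (h.2 c).trans_eq ?_
      rw [← sum_gram, ← sum_gram]
      simp only [Finsupp.sum, Finset.mul_sum, ← Finset.sum_sub_distrib, Matrix.of_apply,
        inner_expVec]
      exact Finset.sum_congr rfl fun i _ => Finset.sum_congr rfl fun j _ => by ring
    rw [inner_self_eq_ofReal, inner_self_eq_ofReal] at h1
    have h2 : 0 ≤ C ^ 2 * ‖Finsupp.linearCombination ℂ expVec c‖ ^ 2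
        - ‖Finsupp.linearCombination ℂ g c‖ ^ 2 := by
      exact_mod_cast h1
    refine le_of_sq_le_sq ?_ (by positivity)
    rw [mul_pow]
    linarith
  have := LinearMap.extendOfNorm_eq expVec_dense ⟨C, hb⟩ (Finsupp.single ξ 1)
  simpa [opOfExp] using this

theorem opOfExp_apply_of_inner (g : H → Fock H) (C : ℝ) (hC : 0 ≤ C)
    (h : ∀ ξ η, ⟪g ξ, g η⟫_ℂ = (C : ℂ) ^ 2 * Complex.exp ⟪ξ, η⟫_ℂ)
    (ξ : H) : opOfExp g (expVec ξ) = g ξ := by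
  refine opOfExp_apply g C hC ?_ ξ
  simp only [h, sub_self]
  exact Matrix.PosSemidef.zero

/-- The Weyl operator `W(ξ)`, with `W(ξ) e(η) = exp (-‖ξ‖² / 2 - ⟪ξ, η⟫) e(ξ + η)`. -/
def weyl (ξ : H) : Fock H →L[ℂ] Fock H :=
  opOfExp fun η => Complex.exp (-(‖ξ‖ : ℂ) ^ 2 / 2 - ⟪ξ, η⟫_ℂ) • expVec (ξ + η)

theorem weyl_expVec (ξ η : H) : weyl ξ (expVec η) =
    Complex.exp (-(‖ξ‖ : ℂ) ^ 2 / 2 - ⟪ξ, η⟫_ℂ) • expVec (ξ + η) := by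
  refine opOfExp_apply_of_inner (fun η => Complex.exp (-(‖ξ‖ : ℂ) ^ 2 / 2 - ⟪ξ, η⟫_ℂ) •
    expVec (ξ + η)) 1 zero_le_one (fun η ζ => ?_) η
  rw [inner_smul_left, inner_smul_right, inner_expVec, ← Complex.exp_conj, ← Complex.exp_add,
    ← Complex.exp_add]
  simp only [map_sub, map_div₀, map_neg, map_pow, Complex.conj_ofReal, inner_conj_symm,
    inner_add_left, inner_add_right, inner_self_eq_norm_sq_to_K, map_ofNat, Complex.ofReal_one,
    one_pow, one_mul]
  congr 1
  simp
  ring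

variable [CompleteSpace H]

/-- For an isometry `V` and `ξ ∈ ker V*`, the bounded operator `e(η) ↦ e(ξ + V η)` on `Γ(H)`,
that is, `b ↦ e(ξ) ⊗ Γ(V) b` under `Γ(H) = Γ(ker V*) ⊗ Γ(ran V)`. -/
def fockShift (V : H →ₗᵢ[ℂ] H) (ξ : H) : Fock H →L[ℂ] Fock H :=
  opOfExp fun η => expVec (ξ + V η)

theorem adjoint_apply_isometry (V : H →ₗᵢ[ℂ] H) (η : H) :
    V.toContinuousLinearMap.adjoint (V η) = η := by
  refine ext_inner_right ℂ fun ζ => ?_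
  rw [ContinuousLinearMap.adjoint_inner_left]
  exact V.inner_map_map η ζ

theorem inner_isometry_eq_zero {V : H →ₗᵢ[ℂ] H} {ξ : H}
    (hξ : V.toContinuousLinearMap.adjoint ξ = 0) (η : H) : ⟪ξ, V η⟫_ℂ = 0 := by
  have := ContinuousLinearMap.adjoint_inner_left V.toContinuousLinearMap η ξ
  rw [hξ, inner_zero_left] at this
  exact this.symm

theorem inner_isometry_add {V : H →ₗᵢ[ℂ] H} {ξ ξ' : H}
    (hξ : V.toContinuousLinearMap.adjoint ξ = 0) (hξ' : V.toContinuousLinearMap.adjoint ξ' = 0)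
    (η η' : H) : ⟪ξ + V η, ξ' + V η'⟫_ℂ = ⟪ξ, ξ'⟫_ℂ + ⟪η, η'⟫_ℂ := by
  have h : ⟪V η, ξ'⟫_ℂ = 0 := inner_eq_zero_symm.1 (inner_isometry_eq_zero hξ' η)
  rw [inner_add_left, inner_add_right, inner_add_right, inner_isometry_eq_zero hξ, h,
    V.inner_map_map]
  ring

theorem fockShift_expVec {V : H →ₗᵢ[ℂ] H} {ξ : H}
    (hξ : V.toContinuousLinearMap.adjoint ξ = 0) (η : H) :
    fockShift V ξ (expVec η) = expVec (ξ + V η) := by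
  refine opOfExp_apply_of_inner (fun η => expVec (ξ + V η)) (Real.exp (‖ξ‖ ^ 2 / 2))
    (Real.exp_nonneg _) (fun η ζ => ?_) η
  rw [inner_expVec, inner_isometry_add hξ hξ, Complex.exp_add, inner_self_eq_ofReal,
    Complex.ofReal_exp, ← Complex.exp_nat_mul]
  congr 2
  push_cast
  ring

theorem inner_fockShift {V : H →ₗᵢ[ℂ] H} {ξ ξ' : H}
    (hξ : V.toContinuousLinearMap.adjoint ξ = 0) (hξ' : V.toContinuousLinearMap.adjoint ξ' = 0)
    (a b : Fock H) : ⟪fockShift V ξ a, fockShift V ξ' b⟫_ℂ = Complex.exp ⟪ξ, ξ'⟫_ℂ * ⟪a, b⟫_ℂ := by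
  have key : (fockShift V ξ).adjoint ∘L fockShift V ξ' = Complex.exp ⟪ξ, ξ'⟫_ℂ • 1 := by
    refine ext_expVec fun η => ?_
    have : innerSL ℂ (((fockShift V ξ).adjoint ∘L fockShift V ξ') (expVec η)) =
        innerSL ℂ ((Complex.exp ⟪ξ, ξ'⟫_ℂ • (1 : Fock H →L[ℂ] Fock H)) (expVec η)) := by
      refine ext_expVec fun ζ => ?_
      simp only [innerSL_apply_apply, ContinuousLinearMap.comp_apply,
        ContinuousLinearMap.adjoint_inner_left, fockShift_expVec hξ, fockShift_expVec hξ',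
        FunLike.coe_smul, Pi.smul_apply, one_apply_eq_self, inner_smul_left,
        inner_expVec, inner_isometry_add hξ' hξ, Complex.exp_add, ← Complex.exp_conj,
        inner_conj_symm]
    exact (innerSL_inj).1 this
  rw [← ContinuousLinearMap.adjoint_inner_right, ← ContinuousLinearMap.comp_apply, key]
  simp [inner_smul_right]

theorem adjoint_sub_proj (V : H →ₗᵢ[ℂ] H) (η : H) :
    V.toContinuousLinearMap.adjoint (η - V (V.toContinuousLinearMap.adjoint η)) = 0 := by
  rw [map_sub, adjoint_apply_isometry, sub_self]

/-- The operator `1 ⊗ Γ(V) A Γ(V)*` on `Γ(H) = Γ(ker V*) ⊗ Γ(ran V)`, given on exponential vectors;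
it is the unique bounded operator `B` with `B (e(ξ) ⊗ Γ(V) b) = e(ξ) ⊗ Γ(V) A b` for `ξ ∈ ker V*`. -/
def ccrFun (V : H →ₗᵢ[ℂ] H) (A : Fock H →L[ℂ] Fock H) : Fock H →L[ℂ] Fock H :=
  opOfExp fun η => fockShift V (η - V (V.toContinuousLinearMap.adjoint η))
    (A (expVec (V.toContinuousLinearMap.adjoint η)))

theorem ccrFun_expVec (V : H →ₗᵢ[ℂ] H) (A : Fock H →L[ℂ] Fock H) (η : H) :
    ccrFun V A (expVec η) = fockShift V (η - V (V.toContinuousLinearMap.adjoint η))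
      (A (expVec (V.toContinuousLinearMap.adjoint η))) := by
  refine opOfExp_apply (fun η => fockShift V (η - V (V.toContinuousLinearMap.adjoint η))
    (A (expVec (V.toContinuousLinearMap.adjoint η)))) ‖A‖ (norm_nonneg _) ?_ η
  have h1 : (Matrix.of fun ξ η : H => (‖A‖ : ℂ) ^ 2 *
      ⟪expVec (V.toContinuousLinearMap.adjoint ξ), expVec (V.toContinuousLinearMap.adjoint η)⟫_ℂ -
      ⟪A (expVec (V.toContinuousLinearMap.adjoint ξ)),
        A (expVec (V.toContinuousLinearMap.adjoint η))⟫_ℂ).PosSemidef := by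
    set u : H → Fock H := fun ξ => expVec (V.toContinuousLinearMap.adjoint ξ) with hu
    refine ⟨Matrix.IsHermitian.ext fun i j => by simp, fun c => ?_⟩
    have h2 : (0 : ℂ) ≤ (‖A‖ : ℂ) ^ 2 * ⟪Finsupp.linearCombination ℂ u c,
        Finsupp.linearCombination ℂ u c⟫_ℂ
        - ⟪Finsupp.linearCombination ℂ (fun ξ => A (u ξ)) c,
            Finsupp.linearCombination ℂ (fun ξ => A (u ξ)) c⟫_ℂ := by
      have h3 : Finsupp.linearCombination ℂ (fun ξ => A (u ξ)) c
          = A (Finsupp.linearCombination ℂ u c) := by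
        simp [Finsupp.linearCombination_apply, Finsupp.sum]
      have h4 := A.le_opNorm (Finsupp.linearCombination ℂ u c)
      have h5 : ‖A (Finsupp.linearCombination ℂ u c)‖ ^ 2 ≤
          ‖A‖ ^ 2 * ‖Finsupp.linearCombination ℂ u c‖ ^ 2 := by
        rw [← mul_pow]; gcongr
      rw [h3, inner_self_eq_ofReal, inner_self_eq_ofReal, sub_nonneg]
      exact_mod_cast h5
    refine h2.trans_eq ?_
    rw [← sum_gram, ← sum_gram]
    simp only [Finsupp.sum, Finset.mul_sum, ← Finset.sum_sub_distrib, Matrix.of_apply]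
    exact Finset.sum_congr rfl fun i _ => Finset.sum_congr rfl fun j _ => by ring
  convert! (posSemidef_exp (posSemidef_inner
    (fun ξ : H => ξ - V (V.toContinuousLinearMap.adjoint ξ)))).hadamard h1 using 1
  ext ξ η
  have h6 : ⟪ξ, η⟫_ℂ = ⟪ξ - V (V.toContinuousLinearMap.adjoint ξ),
      η - V (V.toContinuousLinearMap.adjoint η)⟫_ℂ +
      ⟪V.toContinuousLinearMap.adjoint ξ, V.toContinuousLinearMap.adjoint η⟫_ℂ := by
    rw [← inner_isometry_add (adjoint_sub_proj V ξ) (adjoint_sub_proj V η), sub_add_cancel,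
      sub_add_cancel]
  simp only [Matrix.of_apply, Matrix.hadamard_apply, inner_expVec,
    inner_fockShift (adjoint_sub_proj V ξ) (adjoint_sub_proj V η)]
  rw [h6, Complex.exp_add]
  ring

theorem ccrFun_fockShift (V : H →ₗᵢ[ℂ] H) (A : Fock H →L[ℂ] Fock H) {ξ : H}
    (hξ : V.toContinuousLinearMap.adjoint ξ = 0) :
    ccrFun V A ∘L fockShift V ξ = fockShift V ξ ∘L A := by
  refine ext_expVec fun η => ?_
  have h : V.toContinuousLinearMap.adjoint (ξ + V η) = η := by
    rw [map_add, hξ, zero_add, adjoint_apply_isometry]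
  simp only [ContinuousLinearMap.comp_apply, fockShift_expVec hξ, ccrFun_expVec, h,
    add_sub_cancel_right]

theorem ext_fockShift {F : Type*} [NormedAddCommGroup F] [NormedSpace ℂ F] (V : H →ₗᵢ[ℂ] H)
    {S T : Fock H →L[ℂ] F}
    (h : ∀ ξ, V.toContinuousLinearMap.adjoint ξ = 0 → S ∘L fockShift V ξ = T ∘L fockShift V ξ) :
    S = T := by
  refine ext_expVec fun η => ?_
  have h1 := h _ (adjoint_sub_proj V η)
  have h2 := DFunLike.congr_fun h1 (expVec (V.toContinuousLinearMap.adjoint η))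
  simpa [fockShift_expVec (adjoint_sub_proj V η)] using h2

theorem ccrFun_one (V : H →ₗᵢ[ℂ] H) : ccrFun V 1 = 1 :=
  ext_fockShift V fun ξ hξ => by
    rw [ccrFun_fockShift V _ hξ]; rfl

theorem ccrFun_mul (V : H →ₗᵢ[ℂ] H) (A B : Fock H →L[ℂ] Fock H) :
    ccrFun V (A * B) = ccrFun V A * ccrFun V B :=
  ext_fockShift V fun ξ hξ => by
    rw [ccrFun_fockShift V _ hξ, ContinuousLinearMap.mul_def, ContinuousLinearMap.mul_def,
      ContinuousLinearMap.comp_assoc, ccrFun_fockShift V B hξ, ← ContinuousLinearMap.comp_assoc,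
      ← ContinuousLinearMap.comp_assoc, ccrFun_fockShift V A hξ]

theorem ccrFun_add (V : H →ₗᵢ[ℂ] H) (A B : Fock H →L[ℂ] Fock H) :
    ccrFun V (A + B) = ccrFun V A + ccrFun V B :=
  ext_fockShift V fun ξ hξ => by
    rw [ccrFun_fockShift V _ hξ, ContinuousLinearMap.add_comp, ContinuousLinearMap.comp_add,
      ccrFun_fockShift V _ hξ, ccrFun_fockShift V _ hξ]

theorem ccrFun_smul (V : H →ₗᵢ[ℂ] H) (z : ℂ) (A : Fock H →L[ℂ] Fock H) :
    ccrFun V (z • A) = z • ccrFun V A :=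
  ext_fockShift V fun ξ hξ => by
    rw [ccrFun_fockShift V _ hξ, ContinuousLinearMap.smul_comp, ContinuousLinearMap.comp_smul,
      ccrFun_fockShift V _ hξ]

theorem ccrFun_star (V : H →ₗᵢ[ℂ] H) (A : Fock H →L[ℂ] Fock H) :
    ccrFun V A.adjoint = (ccrFun V A).adjoint := by
  have h : ∀ B : Fock H →L[ℂ] Fock H, ∀ ξ η : H,
      ⟪expVec ξ, ccrFun V B (expVec η)⟫_ℂ =
        Complex.exp ⟪ξ - V (V.toContinuousLinearMap.adjoint ξ),
          η - V (V.toContinuousLinearMap.adjoint η)⟫_ℂ *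
        ⟪expVec (V.toContinuousLinearMap.adjoint ξ),
          B (expVec (V.toContinuousLinearMap.adjoint η))⟫_ℂ := by
    intro B ξ η
    rw [ccrFun_expVec, ← inner_fockShift (adjoint_sub_proj V ξ) (adjoint_sub_proj V η),
      fockShift_expVec (adjoint_sub_proj V ξ), sub_add_cancel]
  refine ext_expVec fun η => ?_
  refine (innerSL_inj (𝕜 := ℂ)).1 (ext_expVec fun ξ => ?_)
  rw [innerSL_apply_apply, innerSL_apply_apply, ContinuousLinearMap.adjoint_inner_left, h,
    ← inner_conj_symm, h, map_mul, ← Complex.exp_conj, inner_conj_symm, inner_conj_symm,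
    ContinuousLinearMap.adjoint_inner_left]

/-- The unital normal `*`-endomorphism `A ↦ 1 ⊗ Γ(V) A Γ(V)*` of `B(Γ(H))` determined by an isometry
`V`; it maps the Weyl operator `W(ξ)` to `W(V ξ)`, see `ccrEndo_weyl`. -/
def ccrEndo (V : H →ₗᵢ[ℂ] H) : (Fock H →L[ℂ] Fock H) →⋆ₐ[ℂ] (Fock H →L[ℂ] Fock H) where
  toFun := ccrFun V
  map_one' := ccrFun_one V
  map_mul' := ccrFun_mul V
  map_zero' := by simpa using ccrFun_smul V 0 0
  map_add' := ccrFun_add V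
  commutes' z := by
    rw [Algebra.algebraMap_eq_smul_one, ccrFun_smul, ccrFun_one]
  map_star' := ccrFun_star V

theorem ccrEndo_weyl (V : H →ₗᵢ[ℂ] H) (ξ : H) : ccrEndo V (weyl ξ) = weyl (V ξ) := by
  refine ext_fockShift V fun ζ hζ => (ccrFun_fockShift V _ hζ).trans ?_
  refine ext_expVec fun η => ?_
  have h : ⟪V ξ, ζ⟫_ℂ = 0 := inner_eq_zero_symm.1 (inner_isometry_eq_zero hζ ξ)
  simp only [ContinuousLinearMap.comp_apply, weyl_expVec, fockShift_expVec hζ, map_smul,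
    V.norm_map, inner_add_right, h, V.inner_map_map, zero_add, map_add]
  rw [add_left_comm]

end Fock

section Flows

variable {G : Type*} [Group G] {P : Submonoid G}
  {H : Type*} [NormedAddCommGroup H] [InnerProductSpace ℂ H]

/-- `ξ` is an additive cocycle of the isometric representation `V` of `P`. -/
structure IsAdditiveCocycle [TopologicalSpace G] [CompleteSpace H] (V : P →* (H →ₗᵢ[ℂ] H)) (ξ : P → H) : Prop where
  continuous : Continuous ξ
  mem_ker : ∀ x, (V x).toContinuousLinearMap.adjoint (ξ x) = 0
  map_mul : ∀ x y, ξ (x * y) = ξ x + V x (ξ y)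

/-- The CCR flow `α^V = (α_x)_{x ∈ P}` on `B(Γ(H))` of an isometric representation `V` of `P`. -/
def ccrFlow [CompleteSpace H] (V : P →* (H →ₗᵢ[ℂ] H)) (x : P) :
    (Fock H →L[ℂ] Fock H) →⋆ₐ[ℂ] (Fock H →L[ℂ] Fock H) :=
  ccrEndo (V x)

theorem ccrFlow_weyl [CompleteSpace H] (V : P →* (H →ₗᵢ[ℂ] H)) (x : P) (ξ : H) :
    ccrFlow V x (weyl ξ) = weyl (V x ξ) :=
  ccrEndo_weyl (V x) ξ

variable {F : Type*} [NormedAddCommGroup F] [InnerProductSpace ℂ F] [CompleteSpace F]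

/-- `u = (u_x)_{x ∈ P}` is a unit of the semigroup `α = (α_x)_{x ∈ P}` of `*`-endomorphisms of
`B(F)`. -/
structure IsFlowUnit [TopologicalSpace G]
    (α : P → ((F →L[ℂ] F) →⋆ₐ[ℂ] (F →L[ℂ] F))) (u : P → (F →L[ℂ] F)) : Prop where
  continuous : ∀ f : F, Continuous fun x => u x f
  intertwines : ∀ (x : P) (T : F →L[ℂ] F), α x T * u x = u x * T
  ne_zero : ∀ x, u x ≠ 0
  map_mul : ∀ x y, u (x * y) = u x * u y

/-- `α` has more than one unit up to characters: it has two units which do not differ by a continuous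
homomorphism from `G` to `ℂˣ`. -/
def HasMoreThanOneUnit [TopologicalSpace G]
    (α : P → ((F →L[ℂ] F) →⋆ₐ[ℂ] (F →L[ℂ] F))) : Prop :=
  ∃ u v : P → (F →L[ℂ] F), IsFlowUnit α u ∧ IsFlowUnit α v ∧
    ∀ χ : G →* ℂˣ, Continuous χ → ∃ x : P, v x ≠ (χ x : ℂ) • u x

end Flows

end

end PSpaceCCR

open PSpaceCCR

/-!
The proof rests on three observations.

*Geometry.* An interior point of `P` moves `A` into its interior. Hence, for an interior point `x`,
the set `A \ x A` contains `U ∂A` for some non-empty open `U`. If `∂A` is not compact, `U ∂A` contains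
infinitely many disjoint right translates of a non-empty open set, and these have equal measure as
`G` is unimodular (`isCompact_of_measure_mul_lt_top`). Conversely, for `x = exp X` in `P` the path
`exp (-tX) y` from a point `y` of `A \ x A` leaves `A` in time at most `1`, so that `A \ x A` is contained
in `exp ([0, 1] X) ∂A` (`IsPSpace.exists_isCompact_sdiff_subset`); the case of a general `x` follows,
since `x P` meets the semigroup generated by `exp (L(P))` and `A \ x A ⊆ A \ x p A` for `p ∈ P`.

*Cocycles.* If the sets `A \ x A` have finite measure, their indicator functions form a cocycle. For
the converse, the Ore condition shows that the members `ξ_x` of a cocycle, which live on `A \ x A`, are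
restrictions of one function `f` on `A`, and the cocycle identity says `f (x z) = f z` for `x ∈ P`. By
Fubini's theorem `f` is constant on `(interior P) z` for almost all `z ∈ A`; any two of these open
sets meet, so `f` is constant (`exists_ae_eq_const_of_mul_invariant`). If this constant is not zero,
then square integrability of `ξ_x` means that `A \ x A` has finite measure.

*Units.* For any strongly continuous isometric representation `V`, a cocycle `ξ` gives the unit
`e(ξ_x) ⊗ Γ(V_x)`, which differs from the vacuum unit `Γ(V_x)` if `ξ ≠ 0`. Conversely, let `u` be a unit and let `Φ = e(0)`. As
two intertwiners `S`, `T` of an endomorphism satisfy `S* T ∈ ℂ`, the vacuum expectation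
`⟪Φ, u_x Φ⟫` is multiplicative; it has no zeros, and dividing by it one may assume that it is `1`. The
one-particle components of the vectors `u_x Φ` then form a cocycle
(`IsFlowUnit.isAdditiveCocycle`). If this cocycle is zero, then `u` is the vacuum unit: the function
`⟪e(η), u_x Φ⟫` for `x = exp X` is a product of `n` factors which belong to `exp (X / n)`, the `k`-th of
which differs from `1` by at most a constant multiple of `‖E_k η‖² ‖u_{exp (X / n)} Φ - Φ‖` with
orthogonal projections `E_k` of sum at most `1`, and this tends to `0` for `n → ∞`
(`IsFlowUnit.eq_fockShift_zero`). So if there is no non-zero cocycle, any two units differ by a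
continuous character of `P`, which extends to `G` by the Ore condition (`IsOre.exists_extension`).
-/

namespace PSpaceCCR

/-! ### Topology of the ambient group and of the semigroup -/

section Group

variable {G : Type*} [Group G]

theorem IsOre.exists_mul_inv {P : Submonoid G} (hOre : IsOre P) (g : G) :
    ∃ a ∈ P, ∃ b ∈ P, g = a * b⁻¹ := by
  obtain ⟨a, ha, b, hb, h⟩ := Set.mem_mul.1 (hOre.1.symm ▸ Set.mem_univ g)
  exact ⟨a, ha, b⁻¹, by simpa using hb, by simpa using h.symm⟩

variable [TopologicalSpace G]

theorem interior_nonempty {P : Submonoid G} (hPint : (P : Set G) ⊆ closure (interior (P : Set G))) :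
    (interior (P : Set G)).Nonempty :=
  closure_nonempty_iff.1 ⟨1, hPint P.one_mem⟩

variable [IsTopologicalGroup G]

/-- A connected locally compact group is the union of the powers of a compact neighbourhood of the
identity. -/
theorem sigmaCompactSpace_of_connected [LocallyCompactSpace G] [ConnectedSpace G] :
    SigmaCompactSpace G := by
  obtain ⟨K, hK, hK1⟩ := exists_compact_mem_nhds (1 : G)
  have hL : IsCompact (K ∪ K⁻¹) := hK.union hK.inv
  have hLinv : (K ∪ K⁻¹)⁻¹ = K ∪ K⁻¹ := by
    rw [Set.union_inv, inv_inv, Set.union_comm]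
  let H : Subgroup G :=
    { carrier := ⋃ n : ℕ, (K ∪ K⁻¹) ^ n
      mul_mem' := by
        intro a b ha hb
        obtain ⟨m, hm⟩ := Set.mem_iUnion.1 ha
        obtain ⟨n, hn⟩ := Set.mem_iUnion.1 hb
        exact Set.mem_iUnion.2 ⟨m + n, by rw [pow_add]; exact Set.mul_mem_mul hm hn⟩
      one_mem' := Set.mem_iUnion.2 ⟨0, by simp⟩
      inv_mem' := by
        intro a ha
        obtain ⟨m, hm⟩ := Set.mem_iUnion.1 ha
        refine Set.mem_iUnion.2 ⟨m, ?_⟩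
        rw [← hLinv, inv_pow]
        simpa using hm }
  have hH : (K : Set G) ⊆ H := fun x hx =>
    Set.mem_iUnion.2 ⟨1, by rw [pow_one]; exact Or.inl hx⟩
  have hopen : IsOpen (H : Set G) :=
    Subgroup.isOpen_of_mem_nhds H (Filter.mem_of_superset hK1 hH)
  have hclopen : IsClopen (H : Set G) := ⟨Subgroup.isClosed_of_isOpen H hopen, hopen⟩
  have huniv : (H : Set G) = Set.univ := hclopen.eq_univ ⟨1, H.one_mem⟩
  rw [← isSigmaCompact_univ_iff, ← huniv]
  refine isSigmaCompact_iUnion_of_isCompact _ fun n => ?_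
  induction n with
  | zero => simp
  | succ n ih => rw [pow_succ]; exact ih.mul hL

variable {P : Submonoid G}

theorem interior_mul_mem {x y : G} (hx : x ∈ interior (P : Set G)) (hy : y ∈ P) :
    x * y ∈ interior (P : Set G) := by
  have h : MulOpposite.op y • interior (P : Set G) ⊆ interior (P : Set G) := by
    refine interior_maximal ?_ (isOpen_interior.smul (MulOpposite.op y))
    rintro _ ⟨z, hz, rfl⟩
    exact P.mul_mem (interior_subset hz) hy
  exact h ⟨x, hx, rfl⟩

/-- The identity is a limit of interior points `w` of `P`, and `w⁻¹ x` stays in the interior for `w`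
close to the identity. -/
theorem exists_mem_interior_inv_mul_mem_interior
    (hPint : (P : Set G) ⊆ closure (interior (P : Set G))) {x : G}
    (hx : x ∈ interior (P : Set G)) :
    ∃ w ∈ interior (P : Set G), w⁻¹ * x ∈ interior (P : Set G) := by
  have hc : Continuous fun w : G => w⁻¹ * x := by fun_prop
  have ho : IsOpen ((fun w : G => w⁻¹ * x) ⁻¹' interior (P : Set G)) :=
    isOpen_interior.preimage hc
  obtain ⟨w, hw, hw'⟩ := mem_closure_iff.1 (hPint P.one_mem) _ ho (by simpa using hx)
  exact ⟨w, hw', hw⟩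

theorem IsOre.exists_interior_inv_mul (hOre : IsOre P)
    (hPint : (P : Set G) ⊆ closure (interior (P : Set G))) (g : G) :
    ∃ a ∈ interior (P : Set G), ∃ b ∈ interior (P : Set G), g = a⁻¹ * b := by
  obtain ⟨w, hw⟩ := interior_nonempty hPint
  obtain ⟨a, ha, b, hb, h⟩ := Set.mem_mul.1 (hOre.2.symm ▸ Set.mem_univ g)
  refine ⟨w * a⁻¹, interior_mul_mem hw (by simpa using ha), w * b, interior_mul_mem hw hb, ?_⟩
  rw [← h]
  group

/-- A continuous character `l` of `P` extends to a continuous character of the group of fractions, by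
`a b⁻¹ ↦ l a / l b`. Since `ℂˣ` is commutative, right common multiples suffice both for the extension to
be well defined and for its multiplicativity. -/
theorem IsOre.exists_extension (hOre : IsOre P)
    (hPint : (P : Set G) ⊆ closure (interior (P : Set G))) (l : P →* ℂˣ) (hl : Continuous l) :
    ∃ χ : G →* ℂˣ, Continuous χ ∧ ∀ x : P, χ x = l x := by
  have hex : ∀ g : G, ∃ p : P × P, g = (p.1 : G) * (p.2 : G)⁻¹ := fun g => by
    obtain ⟨a, ha, b, hb, h⟩ := hOre.exists_mul_inv g
    exact ⟨(⟨a, ha⟩, ⟨b, hb⟩), h⟩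
  choose p hp using hex
  have hwd : ∀ a b c d : P, (a : G) * (b : G)⁻¹ = (c : G) * (d : G)⁻¹ →
      l a * (l b)⁻¹ = l c * (l d)⁻¹ := by
    intro a b c d h
    obtain ⟨q, hq⟩ : ∃ q : P × P, (b : G)⁻¹ * d = (q.1 : G) * (q.2 : G)⁻¹ := ⟨p _, hp _⟩
    have h1 : b * q.1 = d * q.2 := by
      apply Subtype.ext
      have : (q.1 : G) = (b : G)⁻¹ * d * q.2 := by rw [hq]; group
      rw [Submonoid.coe_mul, Submonoid.coe_mul, this]
      group
    have h2 : a * q.1 = c * q.2 := by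
      apply Subtype.ext
      have : (q.1 : G) = (b : G)⁻¹ * d * q.2 := by rw [hq]; group
      rw [Submonoid.coe_mul, Submonoid.coe_mul, this]
      calc (a : G) * ((b : G)⁻¹ * d * q.2) = (a * (b : G)⁻¹) * d * q.2 := by group
        _ = c * q.2 := by rw [h]; group
    have h3 := congrArg l h1
    have h4 := congrArg l h2
    rw [map_mul, map_mul] at h3 h4
    have h5 : l a * l d * l q.1 * l q.2 = l c * l b * l q.1 * l q.2 := by
      calc l a * l d * l q.1 * l q.2 = (l a * l q.1) * (l d * l q.2) := by
            simp only [mul_comm, mul_left_comm]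
        _ = (l c * l q.2) * (l b * l q.1) := by rw [h4, h3]
        _ = _ := by simp only [mul_comm, mul_left_comm]
    rw [mul_inv_eq_iff_eq_mul, mul_right_comm, eq_mul_inv_iff_mul_eq]
    exact mul_right_cancel (mul_right_cancel h5)
  have hmul : ∀ g h : G, l (p (g * h)).1 * (l (p (g * h)).2)⁻¹ =
      (l (p g).1 * (l (p g).2)⁻¹) * (l (p h).1 * (l (p h).2)⁻¹) := by
    intro g h
    obtain ⟨q, hq⟩ : ∃ q : P × P, ((p g).2 : G)⁻¹ * (p h).1 = (q.1 : G) * (q.2 : G)⁻¹ :=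
      ⟨p _, hp _⟩
    have h1 : l (p (g * h)).1 * (l (p (g * h)).2)⁻¹ =
        l ((p g).1 * q.1) * (l ((p h).2 * q.2))⁻¹ := by
      refine hwd _ _ _ _ ?_
      rw [← hp (g * h)]
      conv_lhs => rw [hp g, hp h]
      rw [Submonoid.coe_mul, Submonoid.coe_mul]
      calc ((p g).1 : G) * ((p g).2 : G)⁻¹ * ((p h).1 * ((p h).2 : G)⁻¹)
          = (p g).1 * (((p g).2 : G)⁻¹ * (p h).1) * ((p h).2 : G)⁻¹ := by group
        _ = _ := by rw [hq]; group
    have h2 : l ((p h).1 * q.2) = l ((p g).2 * q.1) := by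
      congr 1
      apply Subtype.ext
      have : (q.1 : G) = ((p g).2 : G)⁻¹ * (p h).1 * q.2 := by rw [hq]; group
      rw [Submonoid.coe_mul, Submonoid.coe_mul, this]
      group
    rw [map_mul, map_mul] at h2
    have h3 : l q.1 = (l (p g).2)⁻¹ * (l (p h).1 * l q.2) := by rw [h2]; group
    have h4 : ∀ a b c d e : ℂˣ, a * (b * (c * e)) * (d * e⁻¹) = a * b * (c * d) := by
      intro a b c d e
      rw [mul_comm d, mul_assoc a, mul_assoc a, mul_assoc b, mul_assoc c, mul_inv_cancel_left]
    rw [h1, map_mul, map_mul, h3, mul_inv, h4]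
  let χ : G →* ℂˣ := MonoidHom.mk' (fun g => l (p g).1 * (l (p g).2)⁻¹) hmul
  have hχ : ∀ x : P, χ x = l x := fun x => by
    have := hwd (p x).1 (p x).2 x 1 (by rw [← hp]; simp)
    simpa [χ] using this
  refine ⟨χ, ?_, hχ⟩
  obtain ⟨w, hw⟩ := interior_nonempty hPint
  -- Continuity at one interior point of `P`, hence everywhere by homogeneity.
  have hcw : ContinuousAt χ w := by
    have h1 : ContinuousOn χ (P : Set G) := by
      rw [continuousOn_iff_continuous_domRestrict]
      refine hl.congr fun x => ?_
      exact (hχ x).symm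
    exact h1.continuousAt (mem_interior_iff_mem_nhds.1 hw)
  refine continuous_of_continuousAt_one χ ?_
  have h2 : ContinuousAt (fun g : G => (χ w)⁻¹ * χ (w * g)) 1 := by
    refine ContinuousAt.mul continuousAt_const ?_
    refine ContinuousAt.comp (f := fun g => w * g) ?_ (by fun_prop)
    simpa using hcw
  refine h2.congr (Filter.Eventually.of_forall fun g => ?_)
  simp

end Group

/-! ### One-parameter semigroups -/

section Rays

variable {E : Type*} [NormedAddCommGroup E] [NormedSpace ℝ E]
  {G : Type*} [Group G] [TopologicalSpace G] [ChartedSpace E G]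

theorem continuous_expCurve (X : GroupLieAlgebra 𝓘(ℝ, E) G) : Continuous (expCurve E X) := by
  unfold expCurve
  split_ifs with h
  · exact h.choose_spec.contMDiff.continuous
  · exact continuous_const

theorem expCurve_zero (X : GroupLieAlgebra 𝓘(ℝ, E) G) : expCurve E X 0 = 1 := by
  unfold expCurve
  split_ifs with h
  · exact h.choose_spec.map_zero
  · rfl

theorem expCurve_add (X : GroupLieAlgebra 𝓘(ℝ, E) G) (s t : ℝ) :
    expCurve E X (s + t) = expCurve E X s * expCurve E X t := by
  unfold expCurve
  split_ifs with h
  · exact h.choose_spec.map_add s t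
  · simp

theorem expCurve_natCast_mul (X : GroupLieAlgebra 𝓘(ℝ, E) G) (n : ℕ) (t : ℝ) :
    expCurve E X (n * t) = expCurve E X t ^ n := by
  induction n with
  | zero => simp [expCurve_zero]
  | succ n ih => rw [Nat.cast_succ, add_mul, one_mul, expCurve_add, ih, pow_succ]

theorem expCurve_pow_div (X : GroupLieAlgebra 𝓘(ℝ, E) G) (n : ℕ) (hn : n ≠ 0) :
    expCurve E X (1 / n) ^ n = expCurve E X 1 := by
  rw [← expCurve_natCast_mul, mul_one_div_cancel (by exact_mod_cast hn)]

variable {P : Submonoid G}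

/-- A property of the elements of a Lie semigroup `P` which is stable under products holds, for
each `x ∈ P`, at some point of `x • interior P`, as soon as it holds on the rays `exp (L(P))`. -/
theorem IsLieSemigroup.exists_inv_mul_mem_interior [IsTopologicalGroup G]
    (hP : IsLieSemigroup E P) (hPint : (P : Set G) ⊆ closure (interior (P : Set G)))
    (p : P → Prop) (hmul : ∀ x y, p x → p y → p (x * y))
    (hray : ∀ X (hX : X ∈ lieWedge E P), p ⟨expCurve E X 1, hX 1 zero_le_one⟩) (x : P) :
    ∃ s : P, p s ∧ (x : G)⁻¹ * s ∈ interior (P : Set G) := by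
  obtain ⟨w, hw⟩ := interior_nonempty hPint
  have ho : IsOpen ((fun s : G => (x : G)⁻¹ * s) ⁻¹' interior (P : Set G)) :=
    isOpen_interior.preimage (by fun_prop)
  obtain ⟨s, hs, hs'⟩ := mem_closure_iff.1 (hP.dense (P.mul_mem x.2 (interior_subset hw))) _ ho
    (by simpa using hw)
  have hall : ∀ s ∈ Subsemigroup.closure ((fun X => expCurve E X 1) '' lieWedge E P),
      ∃ h : s ∈ P, p ⟨s, h⟩ := by
    intro s hs
    induction hs using Subsemigroup.closure_induction with
    | mem s hs =>
      obtain ⟨X, hX, rfl⟩ := hs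
      exact ⟨_, hray X hX⟩
    | mul s t _ _ hs ht => exact ⟨_, hmul _ _ hs.choose_spec ht.choose_spec⟩
  obtain ⟨h, hps⟩ := hall s hs'
  exact ⟨⟨s, h⟩, hps, hs⟩

/-- A closed property of the elements of a Lie semigroup `P` which is stable under products holds
on `P` as soon as it holds on the rays `exp (L(P))`. -/
theorem IsLieSemigroup.induction_closed (hP : IsLieSemigroup E P)
    (p : P → Prop) (hclosed : IsClosed {x | p x}) (hmul : ∀ x y, p x → p y → p (x * y))
    (hray : ∀ X (hX : X ∈ lieWedge E P), p ⟨expCurve E X 1, hX 1 zero_le_one⟩) (x : P) : p x := by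
  have hC : IsClosed (Subtype.val '' {x | p x} : Set G) :=
    hP.isClosed.isClosedEmbedding_subtypeVal.isClosedMap _ hclosed
  have hsub : (Subsemigroup.closure ((fun X => expCurve E X 1) '' lieWedge E P) : Set G) ⊆
      Subtype.val '' {x | p x} := by
    intro s hs
    induction hs using Subsemigroup.closure_induction with
    | mem s hs =>
      obtain ⟨X, hX, rfl⟩ := hs
      exact ⟨_, hray X hX, rfl⟩
    | mul s t _ _ hs ht =>
      obtain ⟨a, ha, rfl⟩ := hs
      obtain ⟨b, hb, rfl⟩ := ht
      exact ⟨a * b, hmul a b ha hb, rfl⟩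
  obtain ⟨y, hy, hxy⟩ := closure_minimal hsub hC (hP.dense x.2)
  rwa [← Subtype.ext hxy]

end Rays

/-! ### Geometry of `P`-spaces -/

section Geometry

variable {G : Type*} [Group G] {P : Submonoid G} {A : Set G}

theorem mem_smul_iff {x y : G} : y ∈ x • A ↔ x⁻¹ * y ∈ A := by
  rw [Set.mem_smul_set_iff_inv_smul_mem, smul_eq_mul]

open Classical in
theorem indicator_sdiff_smul_apply {x y : G} (hy : y ∈ A) (c : ℂ) :
    (A \ x • A).indicator (fun _ => c) y = if x⁻¹ * y ∈ A then 0 else c := by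
  rw [Set.indicator_apply]
  simp [hy, mem_smul_iff]

variable [TopologicalSpace G]

theorem IsPSpace.sdiff_subset (hA : IsPSpace P A) {x y : G} (h : x⁻¹ * y ∈ P) :
    A \ x • A ⊆ A \ y • A := by
  refine Set.sdiff_subset_sdiff_right ?_
  intro z hz
  rw [mem_smul_iff] at hz ⊢
  have := hA.mul_mem _ h _ hz
  rwa [← mul_assoc, mul_assoc _ y, mul_inv_cancel, mul_one] at this

/-- No point of `A` lies in all the translates `x • A`, `x ∈ P`. -/
theorem IsPSpace.exists_inv_mul_notMem (hA : IsPSpace P A) (hOre : IsOre P) (z : G) :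
    ∃ x : P, (x : G)⁻¹ * z ∉ A := by
  by_contra! h
  refine hA.ne_univ (Set.eq_univ_of_forall fun g => ?_)
  obtain ⟨a, ha, b, hb, hab⟩ := hOre.exists_mul_inv (g * z⁻¹)
  have h1 := hA.mul_mem a ha _ (h ⟨b, hb⟩)
  rwa [← mul_assoc, ← hab, inv_mul_cancel_right] at h1

variable [IsTopologicalGroup G]

/-- An interior point of `P` moves `A` into its interior. -/
theorem IsPSpace.interior_mul_mem (hA : IsPSpace P A) {w y : G} (hw : w ∈ interior (P : Set G))
    (hy : y ∈ A) : w * y ∈ interior A := by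
  have h : MulOpposite.op y • interior (P : Set G) ⊆ interior A := by
    refine interior_maximal ?_ (isOpen_interior.smul (MulOpposite.op y))
    rintro _ ⟨z, hz, rfl⟩
    exact hA.mul_mem z (interior_subset hz) y hy
  exact h ⟨w, hw, rfl⟩

theorem IsPSpace.interior_inv_mul_notMem (hA : IsPSpace P A) {w y : G}
    (hw : w ∈ interior (P : Set G)) (hy : y ∈ frontier A) : w⁻¹ * y ∉ A := fun h => by
  have := hA.interior_mul_mem hw h
  rw [mul_inv_cancel_left] at this
  exact hy.2 this

theorem IsPSpace.exists_seq_inv_mul_notMem [SecondCountableTopology G]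
    (hA : IsPSpace P A) (hOre : IsOre P) :
    ∃ d : ℕ → P, ∀ z : G, ∃ n, (d n : G)⁻¹ * z ∉ A := by
  have : SecondCountableTopology P := inferInstanceAs (SecondCountableTopology (P : Set G))
  refine ⟨TopologicalSpace.denseSeq P, fun z => ?_⟩
  have hopen : IsOpen {x : P | (x : G)⁻¹ * z ∉ A} :=
    hA.isClosed.isOpen_compl.preimage (by fun_prop : Continuous fun x : P => (x : G)⁻¹ * z)
  exact (TopologicalSpace.denseRange_denseSeq P).exists_mem_open hopen
    (hA.exists_inv_mul_notMem hOre z)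

theorem nonempty_inter_frontier_of_isPreconnected {X : Type*} [TopologicalSpace X] {s t : Set X}
    (hs : IsPreconnected s) (ht : IsClosed t) (h1 : (s ∩ t).Nonempty) (h2 : ¬ s ⊆ t) :
    (s ∩ frontier t).Nonempty := by
  by_contra h
  rw [Set.not_nonempty_iff_eq_empty] at h
  have hsub : s ⊆ interior t ∪ tᶜ := fun x hx => by
    by_cases hxt : x ∈ t
    · by_cases hxi : x ∈ interior t
      · exact Or.inl hxi
      · have : x ∈ s ∩ frontier t := ⟨hx, subset_closure hxt, hxi⟩
        rw [h] at this
        exact this.elim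
    · exact Or.inr hxt
  obtain ⟨x, hx, hxt⟩ := h1
  obtain ⟨y, hy, hyt⟩ := Set.not_subset.1 h2
  have hxi : x ∈ interior t := (hsub hx).resolve_right fun h => h hxt
  obtain ⟨z, -, hz1, hz2⟩ := hs _ _ isOpen_interior ht.isOpen_compl hsub ⟨x, hx, hxi⟩
    ⟨y, hy, hyt⟩
  exact hz2 (interior_subset hz1)

variable {E : Type*} [NormedAddCommGroup E] [NormedSpace ℝ E] [ChartedSpace E G]

/-- If `∂A` is compact, then `A \ xA` is relatively compact: for `x = exp X`, the path
`exp (-tX) y` from `y ∈ A \ xA` leaves `A` in time at most `1`, hence crosses `∂A`. -/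
theorem IsPSpace.exists_isCompact_sdiff_subset (hA : IsPSpace P A) (hP : IsLieSemigroup E P)
    (hPint : (P : Set G) ⊆ closure (interior (P : Set G))) (hc : IsCompact (frontier A)) (x : P) :
    ∃ K, IsCompact K ∧ A \ (x : G) • A ⊆ K := by
  suffices h : ∃ s : P, (∃ K, IsCompact K ∧ A \ (s : G) • A ⊆ K) ∧
      (x : G)⁻¹ * s ∈ interior (P : Set G) by
    obtain ⟨s, ⟨K, hK, hsK⟩, hs⟩ := h
    exact ⟨K, hK, (hA.sdiff_subset (interior_subset hs)).trans hsK⟩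
  refine hP.exists_inv_mul_mem_interior hPint
    (fun x => ∃ K, IsCompact K ∧ A \ (x : G) • A ⊆ K) ?_ ?_ x
  · rintro x y ⟨K, hK, hx⟩ ⟨L, hL, hy⟩
    refine ⟨K ∪ (x : G) • L, hK.union (hL.smul (x : G)), fun z hz => ?_⟩
    by_cases hzx : z ∈ (x : G) • A
    · refine Or.inr ?_
      rw [mem_smul_iff] at hzx ⊢
      refine hy ⟨hzx, fun h => hz.2 ?_⟩
      rw [mem_smul_iff] at h ⊢
      simpa [mul_assoc] using h
    · exact Or.inl (hx ⟨hz.1, hzx⟩)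
  · intro X hX
    refine ⟨(expCurve E X '' Set.Icc 0 1) * frontier A,
      (isCompact_Icc.image (continuous_expCurve X)).mul hc, fun y hy => ?_⟩
    have hcont : Continuous fun t => (expCurve E X t)⁻¹ * y :=
      (continuous_expCurve X).inv.mul continuous_const
    have hconn : IsPreconnected ((fun t => (expCurve E X t)⁻¹ * y) '' Set.Icc 0 1) :=
      isPreconnected_Icc.image _ hcont.continuousOn
    obtain ⟨_, ⟨t, ht, rfl⟩, hfr⟩ := nonempty_inter_frontier_of_isPreconnected hconn hA.isClosed
      ⟨y, ⟨0, by simp, by simp [expCurve_zero]⟩, hy.1⟩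
      (fun h => hy.2 (mem_smul_iff.2 (h ⟨1, by simp, rfl⟩)))
    exact ⟨_, ⟨t, ht, rfl⟩, _, hfr, by simp⟩

/-- For an interior point `x` of `P`, the set `A \ xA` contains `U ∂A` for some non-empty open `U`. -/
theorem IsPSpace.exists_isOpen_mul_frontier_subset (hA : IsPSpace P A)
    (hPint : (P : Set G) ⊆ closure (interior (P : Set G))) {x : G}
    (hx : x ∈ interior (P : Set G)) :
    ∃ U : Set G, IsOpen U ∧ U.Nonempty ∧ U * frontier A ⊆ A \ x • A := by
  obtain ⟨w, hw, hwx⟩ := exists_mem_interior_inv_mul_mem_interior hPint hx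
  refine ⟨interior (P : Set G) ∩ (fun w : G => w⁻¹ * x) ⁻¹' interior (P : Set G),
    isOpen_interior.inter (isOpen_interior.preimage (by fun_prop)), ⟨w, hw, hwx⟩, ?_⟩
  rintro _ ⟨u, ⟨hu, hux⟩, y, hy, rfl⟩
  refine ⟨interior_subset (hA.interior_mul_mem hu (hA.isClosed.frontier_subset hy)), fun h => ?_⟩
  rw [mem_smul_iff] at h
  refine hA.interior_inv_mul_notMem hux hy ?_
  simpa [mul_assoc] using h

variable [LocallyCompactSpace G] [MeasurableSpace G] [BorelSpace G]

/-- If `U S` has finite measure for a non-empty open `U`, then `S` is relatively compact: otherwise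
`U S` contains infinitely many disjoint right translates of a non-empty open set. -/
theorem isCompact_of_measure_mul_lt_top (μ : Measure G) [μ.IsHaarMeasure] [μ.IsMulRightInvariant]
    {U S : Set G} (hU : IsOpen U) (hUne : U.Nonempty) (hS : IsClosed S) (h : μ (U * S) < ⊤) :
    IsCompact S := by
  by_contra hSc
  obtain ⟨u, hu⟩ := hUne
  obtain ⟨K, hK, huK, hKU⟩ := exists_compact_subset hU hu
  have hstep : ∀ F : Finset G, ∃ y ∈ S, ∀ z ∈ F, y ∉ K⁻¹ * K * {z} := by
    intro F
    by_contra! hF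
    refine hSc (IsCompact.of_isClosed_subset
      (F.isCompact_biUnion fun z _ => (hK.inv.mul hK).mul (isCompact_singleton (x := z))) hS ?_)
    intro y hy
    obtain ⟨z, hz, hyz⟩ := hF y hy
    exact Set.mem_biUnion hz hyz
  obtain ⟨y, hyS, hy⟩ : ∃ y : ℕ → G, (∀ n, y n ∈ S) ∧
      ∀ m n, m < n → y n ∉ K⁻¹ * K * {y m} := by
    classical
    obtain ⟨f, hf, hf'⟩ := exists_seq_of_forall_finset_exists (fun y => y ∈ S)
      (fun a b => b ∉ K⁻¹ * K * {a}) (fun F _ => hstep F)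
    exact ⟨f, hf, hf'⟩
  have hpos : 0 < μ (interior K) := isOpen_interior.measure_pos μ ⟨u, huK⟩
  have htrans : ∀ n, μ (MulOpposite.op (y n) • interior K) = μ (interior K) := fun n =>
    measure_smul μ (MulOpposite.op (y n)) _
  have hdisj' : ∀ m n, m < n →
      Disjoint (MulOpposite.op (y m) • interior K) (MulOpposite.op (y n) • interior K) := by
    intro m n hmn
    rw [Set.disjoint_left]
    rintro _ ⟨a, ha, rfl⟩ ⟨b, hb, hab⟩
    simp only [MulOpposite.smul_eq_mul_unop, MulOpposite.unop_op] at hab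
    refine hy m n hmn ⟨b⁻¹ * a, Set.mul_mem_mul (Set.inv_mem_inv.2 (interior_subset hb))
      (interior_subset ha), y m, rfl, ?_⟩
    simp only [mul_assoc, ← hab]
    group
  have hdisj : Pairwise (Function.onFun Disjoint
      fun n => MulOpposite.op (y n) • interior K) := by
    intro m n hmn
    rcases lt_or_gt_of_ne hmn with h | h
    · exact hdisj' m n h
    · exact (hdisj' n m h).symm
  have hsub : (⋃ n, MulOpposite.op (y n) • interior K) ⊆ U * S := by
    refine Set.iUnion_subset fun n => ?_
    rintro _ ⟨a, ha, rfl⟩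
    exact Set.mul_mem_mul (hKU (interior_subset ha)) (hyS n)
  have hinf : μ (⋃ n, MulOpposite.op (y n) • interior K) = ⊤ := by
    rw [measure_iUnion hdisj fun n => (isOpen_interior.smul _).measurableSet]
    simp only [htrans]
    exact ENNReal.tsum_const_eq_top_of_ne_zero hpos.ne'
  exact absurd (measure_mono hsub) (by rw [hinf]; exact not_le.2 h)

theorem IsPSpace.tfae_isCompact_frontier (hA : IsPSpace P A) (hP : IsLieSemigroup E P)
    (hPint : (P : Set G) ⊆ closure (interior (P : Set G)))
    (μ : Measure G) [μ.IsHaarMeasure] [μ.IsMulRightInvariant] :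
    [∀ x ∈ P, μ (A \ x • A) < ⊤,
      ∀ x ∈ interior (P : Set G), μ (A \ x • A) < ⊤,
      IsCompact (frontier A)].TFAE := by
  tfae_have 1 → 2 := fun h x hx => h x (interior_subset hx)
  tfae_have 2 → 3 := fun h => by
    obtain ⟨x, hx⟩ := interior_nonempty hPint
    obtain ⟨U, hU, hUne, hsub⟩ := hA.exists_isOpen_mul_frontier_subset hPint hx
    exact isCompact_of_measure_mul_lt_top μ hU hUne isClosed_frontier
      ((measure_mono hsub).trans_lt (h x hx))
  tfae_have 3 → 1 := fun h x hx => by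
    obtain ⟨K, hK, hsub⟩ := hA.exists_isCompact_sdiff_subset hP hPint h ⟨x, hx⟩
    exact (measure_mono hsub).trans_lt hK.measure_lt_top
  tfae_finish

end Geometry

/-! ### Exponential vectors and the one-particle map -/

section OneParticle

variable {H : Type*} [NormedAddCommGroup H] [InnerProductSpace ℂ H]

theorem inner_expVec_zero_left (η : H) : ⟪expVec (0 : H), expVec η⟫_ℂ = 1 := by
  rw [inner_expVec, inner_zero_left, Complex.exp_zero]

theorem inner_expVec_zero_right (η : H) : ⟪expVec η, expVec (0 : H)⟫_ℂ = 1 := by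
  rw [inner_expVec, inner_zero_right, Complex.exp_zero]

theorem norm_expVec_sq (η : H) : ‖expVec η‖ ^ 2 = Real.exp (‖η‖ ^ 2) := by
  have h := inner_expVec η η
  rw [inner_self_eq_ofReal, inner_self_eq_ofReal] at h
  exact_mod_cast h

theorem expVec_ne_zero (η : H) : expVec η ≠ 0 := fun h => by
  have := inner_expVec_zero_left η
  rw [h, inner_zero_right] at this
  exact zero_ne_one this

theorem ext_inner_expVec {f g : Fock H} (h : ∀ η, ⟪expVec η, f⟫_ℂ = ⟪expVec η, g⟫_ℂ) : f = g := by
  have h1 : innerSL ℂ f = innerSL ℂ g := ext_expVec fun η => by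
    rw [innerSL_apply_apply, innerSL_apply_apply, ← inner_conj_symm, h, inner_conj_symm]
  exact (innerSL_inj).1 h1

theorem smulRight_expVec_zero (f : Fock H) :
    ((innerSL ℂ (expVec (0 : H))).smulRight f) (expVec 0) = f := by
  rw [ContinuousLinearMap.smulRight_apply, innerSL_apply_apply, inner_expVec_zero_left, one_smul]

theorem continuous_expVec : Continuous (expVec : H → Fock H) := by
  refine continuous_iff_continuousAt.2 fun ξ => tendsto_iff_norm_sub_tendsto_zero.2 ?_
  have h1 : ∀ η : H, ‖expVec η - expVec ξ‖ ^ 2 =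
      Real.exp (‖η‖ ^ 2) - 2 * (Complex.exp ⟪η, ξ⟫_ℂ).re + Real.exp (‖ξ‖ ^ 2) := fun η => by
    rw [@norm_sub_sq ℂ, norm_expVec_sq, norm_expVec_sq, inner_expVec]
    rfl
  have h2 : Filter.Tendsto (fun η : H => ‖expVec η - expVec ξ‖ ^ 2) (𝓝 ξ) (𝓝 0) := by
    simp only [h1]
    have hc : Continuous fun η : H =>
        Real.exp (‖η‖ ^ 2) - 2 * (Complex.exp ⟪η, ξ⟫_ℂ).re + Real.exp (‖ξ‖ ^ 2) := by
      fun_prop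
    convert! hc.tendsto ξ using 2
    rw [inner_self_eq_ofReal, ← Complex.ofReal_exp, Complex.ofReal_re]
    ring
  have h3 := h2.sqrt
  simpa [Real.sqrt_sq (norm_nonneg _)] using h3

/-- `∑ c̄ᵢ cⱼ ⟪ζᵢ, ζⱼ⟫` is one of the terms, all of them non-negative, of the expansion of
`∑ c̄ᵢ cⱼ exp ⟪ζᵢ, ζⱼ⟫` in powers of `⟪ζᵢ, ζⱼ⟫`. -/
theorem norm_linearCombination_id_le (c : H →₀ ℂ) :
    ‖Finsupp.linearCombination ℂ (id : H → H) c‖ ≤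
      1 * ‖Finsupp.linearCombination ℂ (expVec : H → Fock H) c‖ := by
  have hpow : ∀ n : ℕ, (Matrix.of fun i j : H => ⟪i, j⟫_ℂ ^ n).PosSemidef := by
    intro n
    induction n with
    | zero =>
      convert! posSemidef_inner (F := ℂ) (fun _ : H => (1 : ℂ)) using 1
      ext i j; simp
    | succ n ih => convert! ih.hadamard (posSemidef_inner (id : H → H)) using 1
  have h1 : HasSum (fun n : ℕ => ((n.factorial : ℂ)⁻¹) *
      (c.sum fun i ci => c.sum fun j cj => star ci * ⟪i, j⟫_ℂ ^ n * cj))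
      (c.sum fun i ci => c.sum fun j cj => star ci * Complex.exp ⟪i, j⟫_ℂ * cj) := by
    simp only [Finsupp.sum, Finset.mul_sum]
    refine hasSum_sum fun i _ => hasSum_sum fun j _ => ?_
    have h2 : HasSum (fun n : ℕ => ⟪i, j⟫_ℂ ^ n / (n.factorial : ℂ)) (Complex.exp ⟪i, j⟫_ℂ) := by
      rw [Complex.exp_eq_exp_ℂ]
      exact NormedSpace.expSeries_div_hasSum_exp _
    convert! (h2.mul_left (star (c i))).mul_right (c j) using 2
    ring
  have h2 := le_hasSum h1 1 fun n _ => mul_nonneg (by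
    rw [← Complex.ofReal_natCast, ← Complex.ofReal_inv]
    exact Complex.zero_le_real.2 (by positivity)) ((hpow n).2 c)
  have h3 := sum_gram (id : H → H) c
  have h4 := sum_gram (expVec : H → Fock H) c
  simp only [inner_expVec, id] at h3 h4
  simp only [pow_one, Nat.factorial_one, Nat.cast_one, inv_one, one_mul] at h2
  rw [h3, h4, inner_self_eq_ofReal, inner_self_eq_ofReal] at h2
  rw [one_mul]
  refine le_of_sq_le_sq ?_ (norm_nonneg _)
  exact_mod_cast h2

variable [CompleteSpace H]

variable (H) in
/-- The projection of the Fock space onto its one-particle subspace `H`, characterised by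
`e(ζ) ↦ ζ`. -/
noncomputable def oneParticle : Fock H →L[ℂ] H :=
  (Finsupp.linearCombination ℂ (id : H → H)).extendOfNorm (Finsupp.linearCombination ℂ expVec)

theorem oneParticle_expVec (ζ : H) : oneParticle H (expVec ζ) = ζ := by
  have := LinearMap.extendOfNorm_eq expVec_dense ⟨1, norm_linearCombination_id_le⟩
    (Finsupp.single ζ (1 : ℂ))
  simpa [oneParticle] using this

theorem norm_oneParticle_le : ‖oneParticle H‖ ≤ 1 :=
  LinearMap.opNorm_extendOfNorm_le expVec_dense zero_le_one norm_linearCombination_id_le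

/-- An exponential vector agrees with its components in degree `0` and `1` up to second order. -/
theorem norm_expVec_sub_le (ζ : H) :
    ‖expVec ζ - expVec 0 - (oneParticle H).adjoint ζ‖ ≤ ‖ζ‖ ^ 2 * Real.exp (‖ζ‖ ^ 2 / 2) := by
  set ι := (oneParticle H).adjoint ζ with hι
  have h0 : ‖ι‖ ≤ ‖ζ‖ := by
    refine ((oneParticle H).adjoint.le_opNorm ζ).trans ?_
    rw [LinearIsometryEquiv.norm_map]
    exact mul_le_of_le_one_left (norm_nonneg _) norm_oneParticle_le
  have h1 : ⟪expVec ζ - expVec 0, ι⟫_ℂ = ((‖ζ‖ ^ 2 : ℝ) : ℂ) := by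
    rw [hι, ContinuousLinearMap.adjoint_inner_right, map_sub, oneParticle_expVec,
      oneParticle_expVec, sub_zero, inner_self_eq_ofReal]
  have h2 : ‖expVec ζ - expVec 0‖ ^ 2 = Real.exp (‖ζ‖ ^ 2) - 1 := by
    rw [@norm_sub_sq ℂ, norm_expVec_sq, norm_expVec_sq, inner_expVec_zero_right]
    simp
    ring
  have h3 : ‖expVec ζ - expVec 0 - ι‖ ^ 2 ≤ Real.exp (‖ζ‖ ^ 2) - 1 - ‖ζ‖ ^ 2 := by
    rw [@norm_sub_sq ℂ, h2, h1]
    have : ‖ι‖ ^ 2 ≤ ‖ζ‖ ^ 2 := by gcongr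
    simp only [RCLike.re_to_complex, Complex.ofReal_re]
    linarith
  have h4 : ∀ t : ℝ, 0 ≤ t → Real.exp t - 1 - t ≤ t ^ 2 * Real.exp t := by
    intro t ht
    -- `exp (-t) ≥ 1 - t` gives `exp t - 1 ≤ t exp t`, used twice.
    have h5 : Real.exp t - 1 ≤ t * Real.exp t := by
      have := Real.add_one_le_exp (-t)
      have h6 : Real.exp (-t) * Real.exp t = 1 := by rw [← Real.exp_add]; simp
      nlinarith [Real.exp_pos t]
    nlinarith [Real.exp_pos t]
  refine le_of_sq_le_sq (h3.trans ((h4 _ (by positivity)).trans_eq ?_)) (by positivity)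
  rw [mul_pow, ← Real.exp_nat_mul]
  congr 2
  push_cast
  ring

end OneParticle

/-! ### Intertwiners of the endomorphism of an isometry -/

section Intertwiners

variable {H : Type*} [NormedAddCommGroup H] [InnerProductSpace ℂ H] [CompleteSpace H]
  {V : H →ₗᵢ[ℂ] H} {S T : Fock H →L[ℂ] Fock H}

theorem fockShift_expVec_zero {ξ : H} (hξ : V.toContinuousLinearMap.adjoint ξ = 0) :
    fockShift V ξ (expVec 0) = expVec ξ := by
  rw [fockShift_expVec hξ, map_zero, add_zero]

theorem fockShift_zero_adjoint_expVec (ζ : H) :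
    (fockShift V 0).adjoint (expVec ζ) = expVec (V.toContinuousLinearMap.adjoint ζ) := by
  refine ext_inner_expVec fun η => ?_
  rw [ContinuousLinearMap.adjoint_inner_right, fockShift_expVec (map_zero _), zero_add,
    inner_expVec, inner_expVec, ContinuousLinearMap.adjoint_inner_right]
  rfl

theorem ccrEndo_mul_fockShift {ξ : H} (hξ : V.toContinuousLinearMap.adjoint ξ = 0)
    (B : Fock H →L[ℂ] Fock H) : ccrEndo V B * fockShift V ξ = fockShift V ξ * B :=
  ccrFun_fockShift V B hξ

/-- Operators which commute with everything are scalar, so any two intertwiners `S`, `T` of the same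
endomorphism satisfy `S* T ∈ ℂ`. -/
theorem inner_of_intertwines (hS : ∀ B, ccrEndo V B * S = S * B)
    (hT : ∀ B, ccrEndo V B * T = T * B) (a b : Fock H) :
    ⟪S a, T b⟫_ℂ = ⟪S (expVec 0), T (expVec 0)⟫_ℂ * ⟪a, b⟫_ℂ := by
  have hcomm : ∀ B : Fock H →L[ℂ] Fock H, ∀ f g : Fock H, ⟪S f, T (B g)⟫_ℂ =
      ⟪S (B.adjoint f), T g⟫_ℂ := by
    intro B f g
    have h1 : T (B g) = ccrEndo V B (T g) := (congrArg (· g) (hT B)).symm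
    have h2 : S (B.adjoint f) = (ccrEndo V B).adjoint (S f) := by
      have h3 : ccrEndo V B.adjoint = (ccrEndo V B).adjoint := ccrFun_star V B
      have h4 := congrArg (· f) (hS B.adjoint)
      rw [h3] at h4
      exact h4.symm
    rw [h1, h2, ContinuousLinearMap.adjoint_inner_left]
  have h1 := hcomm ((innerSL ℂ (expVec (0 : H))).smulRight b) a (expVec 0)
  have h2 : ((innerSL ℂ (expVec (0 : H))).smulRight b).adjoint a = ⟪b, a⟫_ℂ • expVec 0 := by
    refine ext_inner_left ℂ fun f => ?_
    rw [ContinuousLinearMap.adjoint_inner_right]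
    simp [inner_smul_left, inner_smul_right, mul_comm]
  rw [smulRight_expVec_zero, h2, map_smul, inner_smul_left, inner_conj_symm] at h1
  rw [h1, mul_comm]

/-- An intertwiner is determined by its value at the vacuum vector. -/
theorem eq_of_intertwines (hS : ∀ B, ccrEndo V B * S = S * B)
    (hT : ∀ B, ccrEndo V B * T = T * B) (h : S (expVec 0) = T (expVec 0)) : S = T := by
  refine ContinuousLinearMap.ext fun f => ?_
  set B := (innerSL ℂ (expVec (0 : H))).smulRight f
  have hb : B (expVec 0) = f := smulRight_expVec_zero f
  have h1 : S (B (expVec 0)) = ccrEndo V B (S (expVec 0)) := (congrArg (· (expVec 0)) (hS B)).symm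
  have h2 : T (B (expVec 0)) = ccrEndo V B (T (expVec 0)) := (congrArg (· (expVec 0)) (hT B)).symm
  rw [← hb, h1, h2, h]

/-- The factorisation `e(η) = e(η - V V* η) ⊗ Γ(V) e(V* η)`, tested against an intertwiner. -/
theorem inner_expVec_of_intertwines (hT : ∀ B, ccrEndo V B * T = T * B) (η : H) (b : Fock H) :
    ⟪expVec η, T b⟫_ℂ =
      ⟪expVec (η - V (V.toContinuousLinearMap.adjoint η)), T (expVec 0)⟫_ℂ *
        ⟪expVec (V.toContinuousLinearMap.adjoint η), b⟫_ℂ := by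
  have hη := adjoint_sub_proj V η
  have h1 := inner_of_intertwines (ccrEndo_mul_fockShift hη) hT
    (expVec (V.toContinuousLinearMap.adjoint η)) b
  rwa [fockShift_expVec_zero hη, fockShift_expVec hη, sub_add_cancel] at h1

theorem inner_expVec_sub_proj_of_intertwines (hT : ∀ B, ccrEndo V B * T = T * B) (η : H) :
    ⟪expVec (η - V (V.toContinuousLinearMap.adjoint η)), T (expVec 0)⟫_ℂ =
      ⟪expVec η, T (expVec 0)⟫_ℂ := by
  rw [inner_expVec_of_intertwines hT η, inner_expVec_zero_right, mul_one]

theorem adjoint_oneParticle (f : Fock H) :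
    V.toContinuousLinearMap.adjoint (oneParticle H f) =
      oneParticle H ((fockShift V 0).adjoint f) := by
  have : V.toContinuousLinearMap.adjoint ∘L oneParticle H =
      oneParticle H ∘L (fockShift V 0).adjoint := ext_expVec fun ζ => by
    simp only [ContinuousLinearMap.comp_apply, fockShift_zero_adjoint_expVec, oneParticle_expVec]
  exact congrArg (· f) this

theorem adjoint_oneParticle_of_intertwines (hT : ∀ B, ccrEndo V B * T = T * B)
    (hT1 : ⟪expVec 0, T (expVec 0)⟫_ℂ = 1) (f : Fock H) :
    V.toContinuousLinearMap.adjoint (oneParticle H (T f)) = oneParticle H f := by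
  rw [adjoint_oneParticle]
  congr 1
  refine ext_inner_left ℂ fun a => ?_
  have h0 : V.toContinuousLinearMap.adjoint (0 : H) = 0 := map_zero _
  rw [ContinuousLinearMap.adjoint_inner_right, inner_of_intertwines (ccrEndo_mul_fockShift h0) hT,
    fockShift_expVec_zero h0, hT1, one_mul]

/-- A normalised intertwiner acts on one-particle components by `ζ ↦ ξ + V ζ`, where `ξ` is the
one-particle component of the image of the vacuum. The part in `ker V*` is obtained from the
intertwining relation for the vacuum projection, which is mapped to the second quantisation of
`1 - V V*`. -/
theorem oneParticle_of_intertwines (hT : ∀ B, ccrEndo V B * T = T * B)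
    (hT1 : ⟪expVec 0, T (expVec 0)⟫_ℂ = 1) (f : Fock H) :
    oneParticle H (T f) =
      ⟪expVec 0, f⟫_ℂ • oneParticle H (T (expVec 0)) + V (oneParticle H f) := by
  set B := (innerSL ℂ (expVec (0 : H))).smulRight (expVec (0 : H)) with hB
  have h1 : oneParticle H ∘L ccrEndo V B =
      oneParticle H - V.toContinuousLinearMap ∘L V.toContinuousLinearMap.adjoint ∘L oneParticle H :=
    ext_expVec fun ζ => by
      have h2 : ccrEndo V B (expVec ζ) =
          expVec (ζ - V (V.toContinuousLinearMap.adjoint ζ)) := by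
        refine (ccrFun_expVec V B ζ).trans ?_
        rw [hB, ContinuousLinearMap.smulRight_apply, innerSL_apply_apply, inner_expVec_zero_left,
          one_smul, fockShift_expVec_zero (adjoint_sub_proj V ζ)]
      simp only [ContinuousLinearMap.comp_apply, h2, oneParticle_expVec,
        sub_apply]
      rfl
  have h2 : T (B f) = ccrEndo V B (T f) := (congrArg (· f) (hT B)).symm
  have h3 : oneParticle H (ccrEndo V B (T f)) = oneParticle H (T f) - V (oneParticle H f) := by
    refine (congrArg (· (T f)) h1).trans ?_
    rw [← adjoint_oneParticle_of_intertwines hT hT1 f]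
    rfl
  rw [← h2, hB, ContinuousLinearMap.smulRight_apply, innerSL_apply_apply, map_smul, map_smul] at h3
  rw [h3, sub_add_cancel]

theorem norm_sub_proj_sq (η : H) : ‖η - V (V.toContinuousLinearMap.adjoint η)‖ ^ 2 =
    ‖η‖ ^ 2 - ‖V.toContinuousLinearMap.adjoint η‖ ^ 2 := by
  have h := inner_isometry_add (adjoint_sub_proj V η) (adjoint_sub_proj V η)
    (V.toContinuousLinearMap.adjoint η) (V.toContinuousLinearMap.adjoint η)
  rw [sub_add_cancel, inner_self_eq_ofReal, inner_self_eq_ofReal, inner_self_eq_ofReal] at h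
  have h' : ‖η‖ ^ 2 = ‖η - V (V.toContinuousLinearMap.adjoint η)‖ ^ 2 +
      ‖V.toContinuousLinearMap.adjoint η‖ ^ 2 := by exact_mod_cast h
  linarith

theorem norm_adjoint_apply_le (η : H) : ‖V.toContinuousLinearMap.adjoint η‖ ≤ ‖η‖ := by
  have := norm_sub_proj_sq (V := V) η
  exact le_of_sq_le_sq (by nlinarith [sq_nonneg ‖η - V (V.toContinuousLinearMap.adjoint η)‖])
    (norm_nonneg _)

/-- If a normalised intertwiner maps the vacuum to a vector `b` without one-particle component, then
`⟪e(η), b⟫` differs from `1` by a term of second order in `η - V V* η`. -/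
theorem norm_inner_expVec_sub_one_le (hT : ∀ B, ccrEndo V B * T = T * B)
    (hT1 : ⟪expVec 0, T (expVec 0)⟫_ℂ = 1) (hT0 : oneParticle H (T (expVec 0)) = 0) (η : H) :
    ‖⟪expVec η, T (expVec 0)⟫_ℂ - 1‖ ≤
      (‖η‖ ^ 2 - ‖V.toContinuousLinearMap.adjoint η‖ ^ 2) *
        (Real.exp (‖η‖ ^ 2 / 2) * ‖T (expVec 0) - expVec 0‖) := by
  rw [← norm_sub_proj_sq, ← inner_expVec_sub_proj_of_intertwines hT]
  have hle : ‖η - V (V.toContinuousLinearMap.adjoint η)‖ ^ 2 ≤ ‖η‖ ^ 2 := by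
    rw [norm_sub_proj_sq]; linarith [sq_nonneg ‖V.toContinuousLinearMap.adjoint η‖]
  set ζ := η - V (V.toContinuousLinearMap.adjoint η)
  have h1 : ⟪expVec ζ, T (expVec 0)⟫_ℂ - 1 =
      ⟪expVec ζ - expVec 0 - (oneParticle H).adjoint ζ, T (expVec 0) - expVec 0⟫_ℂ := by
    simp only [inner_sub_left, inner_sub_right, ContinuousLinearMap.adjoint_inner_left, hT0,
      inner_expVec_zero_right, hT1, oneParticle_expVec, inner_zero_right]
    ring
  rw [h1, ← mul_assoc]
  refine (norm_inner_le_norm _ _).trans ?_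
  gcongr
  exact (norm_expVec_sub_le ζ).trans (by gcongr)

end Intertwiners

/-! ### Units of CCR flows -/

section Units

variable {E : Type*} [NormedAddCommGroup E] [NormedSpace ℝ E]
  {G : Type*} [Group G] [TopologicalSpace G]
  {P : Submonoid G} {H : Type*} [NormedAddCommGroup H] [InnerProductSpace ℂ H] [CompleteSpace H]
  {V : P →* (H →ₗᵢ[ℂ] H)} {u : P → (Fock H →L[ℂ] Fock H)}

/-- The vacuum expectation `⟪Φ, u_x Φ⟫` of a family of operators. -/
noncomputable def vacuumExpectation (u : P → (Fock H →L[ℂ] Fock H)) (x : P) : ℂ :=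
  ⟪expVec 0, u x (expVec 0)⟫_ℂ

theorem IsFlowUnit.continuous_vacuumExpectation (hu : IsFlowUnit (ccrFlow V) u) :
    Continuous (vacuumExpectation u) :=
  continuous_const.inner (hu.continuous _)

theorem IsFlowUnit.vacuumExpectation_mul (hu : IsFlowUnit (ccrFlow V) u) (x y : P) :
    vacuumExpectation u (x * y) = vacuumExpectation u x * vacuumExpectation u y := by
  have h := inner_expVec_of_intertwines (hu.intertwines x) 0 (u y (expVec 0))
  simpa [vacuumExpectation, hu.map_mul] using h

theorem IsFlowUnit.apply_one (hu : IsFlowUnit (ccrFlow V) u) (b : Fock H) :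
    u 1 b = vacuumExpectation u 1 • b := by
  refine ext_inner_expVec fun η => ?_
  have hη : (V 1).toContinuousLinearMap.adjoint η = η := by
    have := adjoint_apply_isometry (V 1) η
    rwa [map_one V] at this ⊢
  have h1 : V 1 η = η := by rw [map_one V]; rfl
  have h := inner_expVec_of_intertwines (hu.intertwines 1) η b
  rw [hη, h1, sub_self] at h
  rw [h, inner_smul_right]
  rfl

theorem IsFlowUnit.vacuumExpectation_one (hu : IsFlowUnit (ccrFlow V) u) :
    vacuumExpectation u 1 = 1 := by
  have h2 : vacuumExpectation u 1 ≠ 0 := fun h =>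
    hu.ne_zero 1 (ContinuousLinearMap.ext fun b => by rw [hu.apply_one, h, zero_smul]; rfl)
  have h3 := hu.vacuumExpectation_mul 1 1
  rw [mul_one] at h3
  exact (mul_eq_left₀ h2).1 h3.symm

theorem IsFlowUnit.one_apply (hu : IsFlowUnit (ccrFlow V) u) (b : Fock H) : u 1 b = b := by
  rw [hu.apply_one, hu.vacuumExpectation_one, one_smul]

/-- A unit divided by its vacuum expectation is a unit. -/
theorem IsFlowUnit.normalize (hu : IsFlowUnit (ccrFlow V) u)
    (h0 : ∀ x, vacuumExpectation u x ≠ 0) :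
    IsFlowUnit (ccrFlow V) (fun x => (vacuumExpectation u x)⁻¹ • u x) where
  continuous f := (hu.continuous_vacuumExpectation.inv₀ h0).smul (hu.continuous f)
  intertwines x T := by rw [mul_smul_comm, smul_mul_assoc, hu.intertwines]
  ne_zero x := smul_ne_zero (inv_ne_zero (h0 x)) (hu.ne_zero x)
  map_mul x y := by
    rw [hu.vacuumExpectation_mul, hu.map_mul, mul_inv, smul_mul_smul_comm]

/-- The one-particle components of the vectors `u_x Φ` of a normalised unit form an additive
cocycle. -/
theorem IsFlowUnit.isAdditiveCocycle (hu : IsFlowUnit (ccrFlow V) u)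
    (h1 : ∀ x, vacuumExpectation u x = 1) :
    IsAdditiveCocycle V (fun x => oneParticle H (u x (expVec 0))) where
  continuous := (oneParticle H).continuous.comp (hu.continuous _)
  mem_ker x := by
    rw [adjoint_oneParticle_of_intertwines (hu.intertwines x) (h1 x), oneParticle_expVec]
  map_mul x y := by
    rw [hu.map_mul, mul_apply_eq_comp,
      oneParticle_of_intertwines (hu.intertwines x) (h1 x)]
    change vacuumExpectation u y • _ + _ = _
    rw [h1, one_smul]

/-- Along powers the functions `⟪e(η), u_x Φ⟫` multiply, and the second order terms by which the
factors differ from `1` add up to at most `‖η‖²`. -/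
theorem IsFlowUnit.norm_inner_pow_sub_one_le (hu : IsFlowUnit (ccrFlow V) u)
    (h1 : ∀ x, vacuumExpectation u x = 1) (h0 : ∀ x, oneParticle H (u x (expVec 0)) = 0)
    (y : P) (R : ℝ) (n : ℕ) (η : H) (hη : ‖η‖ ≤ R) :
    ‖⟪expVec η, u (y ^ n) (expVec 0)⟫_ℂ - 1‖ ≤
      Real.exp ((‖η‖ ^ 2) * (Real.exp (R ^ 2 / 2) * ‖u y (expVec 0) - expVec 0‖)) - 1 := by
  set C := Real.exp (R ^ 2 / 2) * ‖u y (expVec 0) - expVec 0‖ with hC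
  have hC0 : 0 ≤ C := by positivity
  induction n generalizing η with
  | zero =>
    rw [pow_zero, hu.one_apply, inner_expVec_zero_right, sub_self, norm_zero, sub_nonneg]
    exact Real.one_le_exp (by positivity)
  | succ n ih =>
    set ζ := (V y).toContinuousLinearMap.adjoint η with hζ
    have hζη : ‖ζ‖ ≤ ‖η‖ := norm_adjoint_apply_le η
    have h2 : ⟪expVec η, u (y ^ (n + 1)) (expVec 0)⟫_ℂ =
        ⟪expVec η, u y (expVec 0)⟫_ℂ * ⟪expVec ζ, u (y ^ n) (expVec 0)⟫_ℂ := by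
      rw [pow_succ', hu.map_mul, mul_apply_eq_comp,
        inner_expVec_of_intertwines (hu.intertwines y),
        inner_expVec_sub_proj_of_intertwines (hu.intertwines y)]
    have h3 := ih ζ (hζη.trans hη)
    have h4 : ‖⟪expVec η, u y (expVec 0)⟫_ℂ - 1‖ ≤ (‖η‖ ^ 2 - ‖ζ‖ ^ 2) * C := by
      refine (norm_inner_expVec_sub_one_le (hu.intertwines y) (h1 y) (h0 y) η).trans ?_
      have : 0 ≤ ‖η‖ ^ 2 - ‖ζ‖ ^ 2 := by
        rw [sub_nonneg]; gcongr
      rw [hC]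
      gcongr
    rw [h2]
    set a := ⟪expVec η, u y (expVec 0)⟫_ℂ
    set b := ⟪expVec ζ, u (y ^ n) (expVec 0)⟫_ℂ
    have h6 : a * b - 1 = (a - 1) * (b - 1) + (a - 1) + (b - 1) := by ring
    have h7 : ‖a * b - 1‖ ≤ ‖a - 1‖ * ‖b - 1‖ + ‖a - 1‖ + ‖b - 1‖ := by
      rw [h6]
      exact (norm_add₃_le).trans (by rw [norm_mul])
    have h8 : 1 + ‖a - 1‖ ≤ Real.exp ((‖η‖ ^ 2 - ‖ζ‖ ^ 2) * C) := by
      refine le_trans ?_ (Real.add_one_le_exp _)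
      linarith
    have h9 : 1 + ‖b - 1‖ ≤ Real.exp (‖ζ‖ ^ 2 * C) := by linarith
    have h10 : Real.exp (‖η‖ ^ 2 * C) =
        Real.exp ((‖η‖ ^ 2 - ‖ζ‖ ^ 2) * C) * Real.exp (‖ζ‖ ^ 2 * C) := by
      rw [← Real.exp_add]; congr 1; ring
    have h11 := mul_le_mul h8 h9 (by positivity) (by positivity)
    rw [h10]
    nlinarith

section Lie

variable [ChartedSpace E G]

/-- `x ↦ f x` along `exp (X / n)`, for `n → ∞`. -/
theorem tendsto_expCurve_one_div {α : Type*} [TopologicalSpace α] {f : P → α} (hf : Continuous f)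
    {X : GroupLieAlgebra 𝓘(ℝ, E) G} (hX : X ∈ lieWedge E P) :
    Filter.Tendsto (fun n : ℕ => f ⟨expCurve E X (1 / ((n + 1 : ℕ) : ℝ)), hX _ (by positivity)⟩)
      Filter.atTop (𝓝 (f 1)) := by
  refine (hf.tendsto 1).comp (tendsto_subtype_rng.2 ?_)
  have h1 : Filter.Tendsto (fun n : ℕ => (1 / ((n + 1 : ℕ) : ℝ))) Filter.atTop (𝓝 0) := by
    push_cast
    exact tendsto_one_div_add_atTop_nhds_zero_nat
  have h2 := ((continuous_expCurve X).tendsto 0).comp h1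
  rwa [expCurve_zero] at h2

theorem expCurve_subtype_pow {X : GroupLieAlgebra 𝓘(ℝ, E) G} (hX : X ∈ lieWedge E P) (n : ℕ) :
    (⟨expCurve E X (1 / ((n + 1 : ℕ) : ℝ)), hX _ (by positivity)⟩ : P) ^ (n + 1) =
      ⟨expCurve E X 1, hX 1 zero_le_one⟩ :=
  Subtype.ext (expCurve_pow_div X (n + 1) n.succ_ne_zero)

/-- A normalised unit without one-particle components is the vacuum unit. -/
theorem IsFlowUnit.eq_fockShift_zero (hP : IsLieSemigroup E P) (hu : IsFlowUnit (ccrFlow V) u)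
    (h1 : ∀ x, vacuumExpectation u x = 1) (h0 : ∀ x, oneParticle H (u x (expVec 0)) = 0) (x : P) :
    u x = fockShift (V x) 0 := by
  have h2 : u x (expVec 0) = expVec 0 := by
    refine hP.induction_closed (fun x => u x (expVec 0) = expVec 0)
      (isClosed_eq (hu.continuous _) continuous_const) ?_ ?_ x
    · intro x y hx hy
      rw [hu.map_mul, mul_apply_eq_comp, hy, hx]
    · intro X hX
      refine ext_inner_expVec fun η => ?_
      rw [inner_expVec_zero_right, ← sub_eq_zero, ← norm_le_zero_iff]
      have h3 : Continuous fun y : P => Real.exp ((‖η‖ ^ 2) *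
          (Real.exp (‖η‖ ^ 2 / 2) * ‖u y (expVec 0) - expVec 0‖)) - 1 := by
        have := hu.continuous (expVec 0)
        fun_prop
      have h4 := tendsto_expCurve_one_div h3 hX
      rw [hu.one_apply] at h4
      simp only [sub_self, norm_zero, mul_zero, Real.exp_zero] at h4
      refine ge_of_tendsto' h4 fun n => ?_
      have h6 := hu.norm_inner_pow_sub_one_le h1 h0
        ⟨expCurve E X (1 / ((n + 1 : ℕ) : ℝ)), hX _ (by positivity)⟩ ‖η‖ (n + 1) η le_rfl
      rwa [expCurve_subtype_pow hX n] at h6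
  have h3 : (V x).toContinuousLinearMap.adjoint (0 : H) = 0 := map_zero _
  refine eq_of_intertwines (hu.intertwines x) (ccrEndo_mul_fockShift h3) ?_
  rw [h2, fockShift_expVec_zero h3]

variable [IsTopologicalGroup G]

theorem IsFlowUnit.vacuumExpectation_ne_zero (hP : IsLieSemigroup E P)
    (hPint : (P : Set G) ⊆ closure (interior (P : Set G))) (hu : IsFlowUnit (ccrFlow V) u) (x : P) :
    vacuumExpectation u x ≠ 0 := by
  obtain ⟨s, hs, hxs⟩ : ∃ s : P, vacuumExpectation u s ≠ 0 ∧
      (x : G)⁻¹ * s ∈ interior (P : Set G) := by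
    refine hP.exists_inv_mul_mem_interior hPint (fun x => vacuumExpectation u x ≠ 0) ?_ ?_ x
    · intro x y hx hy
      rw [hu.vacuumExpectation_mul]
      exact mul_ne_zero hx hy
    · intro X hX
      have h1 := tendsto_expCurve_one_div hu.continuous_vacuumExpectation hX
      rw [hu.vacuumExpectation_one] at h1
      obtain ⟨n, hn⟩ := (h1.eventually_ne one_ne_zero).exists
      rw [← expCurve_subtype_pow hX n]
      have hpow : ∀ (y : P) (k : ℕ), vacuumExpectation u (y ^ k) = vacuumExpectation u y ^ k := by
        intro y k
        induction k with
        | zero => simpa using hu.vacuumExpectation_one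
        | succ k ih => rw [pow_succ, hu.vacuumExpectation_mul, ih, pow_succ]
      rw [hpow]
      exact pow_ne_zero _ hn
  have h : s = x * ⟨(x : G)⁻¹ * s, interior_subset hxs⟩ := Subtype.ext (by simp)
  rw [h, hu.vacuumExpectation_mul] at hs
  exact left_ne_zero_of_mul hs

/-- Without non-zero additive cocycles every unit is a multiple of the vacuum unit. -/
theorem IsFlowUnit.eq_smul_fockShift_zero (hP : IsLieSemigroup E P)
    (hPint : (P : Set G) ⊆ closure (interior (P : Set G)))
    (hV : ∀ ξ : P → H, IsAdditiveCocycle V ξ → ξ = 0) (hu : IsFlowUnit (ccrFlow V) u) (x : P) :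
    u x = vacuumExpectation u x • fockShift (V x) 0 := by
  have h0 := hu.vacuumExpectation_ne_zero hP hPint
  have hn := hu.normalize h0
  have h1 : ∀ x, vacuumExpectation (fun x => (vacuumExpectation u x)⁻¹ • u x) x = 1 := fun x => by
    simp only [vacuumExpectation, FunLike.coe_smul, Pi.smul_apply, inner_smul_right]
    exact inv_mul_cancel₀ (h0 x)
  have h2 := hV _ (hn.isAdditiveCocycle h1)
  rw [← hn.eq_fockShift_zero hP h1 (fun x => congrFun h2 x) x, smul_inv_smul₀ (h0 x)]

theorem exists_isAdditiveCocycle_of_hasMoreThanOneUnit (hP : IsLieSemigroup E P)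
    (hPint : (P : Set G) ⊆ closure (interior (P : Set G))) (hOre : IsOre P)
    (h : HasMoreThanOneUnit (ccrFlow V)) : ∃ ξ : P → H, IsAdditiveCocycle V ξ ∧ ξ ≠ 0 := by
  by_contra! hV
  obtain ⟨u, v, hu, hv, huv⟩ := h
  have hu0 := hu.vacuumExpectation_ne_zero hP hPint
  have hv0 := hv.vacuumExpectation_ne_zero hP hPint
  let l : P →* ℂˣ :=
    { toFun := fun x => Units.mk0 (vacuumExpectation v x) (hv0 x) *
        (Units.mk0 (vacuumExpectation u x) (hu0 x))⁻¹
      map_one' := by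
        ext
        simp [hu.vacuumExpectation_one, hv.vacuumExpectation_one]
      map_mul' := fun x y => by
        ext
        simp only [hu.vacuumExpectation_mul, hv.vacuumExpectation_mul, Units.val_mul,
          Units.val_inv_eq_inv_val, Units.val_mk0, mul_inv]
        ring }
  have hl : Continuous l := by
    refine Units.isEmbedding_val₀.continuous_iff.2 ?_
    exact (hv.continuous_vacuumExpectation.mul
      (hu.continuous_vacuumExpectation.inv₀ hu0)).congr fun x => by simp [l]
  obtain ⟨χ, hχ, hχl⟩ := hOre.exists_extension hPint l hl
  obtain ⟨x, hx⟩ := huv χ hχ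
  refine hx ?_
  rw [hχl, hu.eq_smul_fockShift_zero hP hPint hV x, hv.eq_smul_fockShift_zero hP hPint hV x,
    smul_smul]
  congr 1
  simp only [l, MonoidHom.coe_mk, OneHom.coe_mk, Units.val_mul, Units.val_inv_eq_inv_val,
    Units.val_mk0]
  rw [inv_mul_cancel_right₀ (hu0 x)]

end Lie

theorem norm_fockShift_apply {V : H →ₗᵢ[ℂ] H} {ξ : H}
    (hξ : V.toContinuousLinearMap.adjoint ξ = 0) (f : Fock H) :
    ‖fockShift V ξ f‖ = Real.exp (‖ξ‖ ^ 2 / 2) * ‖f‖ := by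
  have h := inner_fockShift hξ hξ f f
  rw [inner_self_eq_ofReal, inner_self_eq_ofReal, inner_self_eq_ofReal, ← Complex.ofReal_exp] at h
  have h1 : ‖fockShift V ξ f‖ ^ 2 = Real.exp (‖ξ‖ ^ 2) * ‖f‖ ^ 2 := by exact_mod_cast h
  refine (sq_eq_sq₀ (norm_nonneg _) (by positivity)).1 ?_
  rw [h1, mul_pow, ← Real.exp_nat_mul]
  congr 2
  push_cast
  ring

theorem norm_exp_smul_fockShift_apply {V : H →ₗᵢ[ℂ] H} {ξ : H}
    (hξ : V.toContinuousLinearMap.adjoint ξ = 0) (f : Fock H) :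
    ‖Real.exp (-(‖ξ‖ ^ 2 / 2)) • fockShift V ξ f‖ = ‖f‖ := by
  rw [norm_smul, norm_fockShift_apply hξ, Real.norm_of_nonneg (Real.exp_nonneg _), ← mul_assoc,
    ← Real.exp_add, neg_add_cancel, Real.exp_zero, one_mul]

/-- Strong continuity of `x ↦ e(ξ_x) ⊗ Γ(V_x)`. The operators `exp (-‖ξ_x‖² / 2) e(ξ_x) ⊗ Γ(V_x)` are
isometries, so that continuity can be checked on the linear span of the exponential vectors. -/
theorem continuous_fockShift_apply {ξ : P → H} (hξ : Continuous ξ)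
    (hker : ∀ x, (V x).toContinuousLinearMap.adjoint (ξ x) = 0)
    (hV : ∀ η, Continuous fun x => V x η) (f : Fock H) :
    Continuous fun x => fockShift (V x) (ξ x) f := by
  have h1 : Continuous fun x => Real.exp (-(‖ξ x‖ ^ 2 / 2)) • fockShift (V x) (ξ x) f := by
    refine continuous_of_uniform_approx_of_continuous fun W hW => ?_
    obtain ⟨ε, hε, hεW⟩ := Metric.mem_uniformity_dist.1 hW
    obtain ⟨c, hc⟩ := expVec_dense.exists_dist_lt f hε
    refine ⟨fun x => Real.exp (-(‖ξ x‖ ^ 2 / 2)) •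
      fockShift (V x) (ξ x) (Finsupp.linearCombination ℂ expVec c), ?_, fun x => hεW ?_⟩
    · have h2 : ∀ x, fockShift (V x) (ξ x) (Finsupp.linearCombination ℂ expVec c) =
          ∑ η ∈ c.support, c η • expVec (ξ x + V x η) := fun x => by
        simp only [Finsupp.linearCombination_apply, Finsupp.sum, map_sum, map_smul,
          fockShift_expVec (hker x)]
      simp only [h2]
      have h3 : ∀ η, Continuous fun x => expVec (ξ x + V x η) := fun η =>
        continuous_expVec.comp (hξ.add (hV η))
      have h4 : Continuous fun x => Real.exp (-(‖ξ x‖ ^ 2 / 2)) := by fun_prop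
      exact h4.smul (continuous_finsetSum _ fun η _ => (continuous_const_smul (c η)).comp (h3 η))
    · rwa [dist_eq_norm, ← smul_sub, ← map_sub, norm_exp_smul_fockShift_apply (hker x),
        ← dist_eq_norm]
  have h2 : Continuous fun x => Real.exp (‖ξ x‖ ^ 2 / 2) := by fun_prop
  refine (h2.smul h1).congr fun x => ?_
  change Real.exp _ • Real.exp _ • fockShift (V x) (ξ x) f = _
  rw [smul_smul, ← Real.exp_add, add_neg_cancel, Real.exp_zero, one_smul]

/-- An additive cocycle `ξ` gives the unit `e(ξ_x) ⊗ Γ(V_x)`. -/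
theorem IsAdditiveCocycle.isFlowUnit {ξ : P → H} (hξ : IsAdditiveCocycle V ξ)
    (hV : ∀ η, Continuous fun x => V x η) :
    IsFlowUnit (ccrFlow V) (fun x => fockShift (V x) (ξ x)) where
  continuous := continuous_fockShift_apply hξ.continuous hξ.mem_ker hV
  intertwines x T := ccrEndo_mul_fockShift (hξ.mem_ker x) T
  ne_zero x h := expVec_ne_zero (ξ x) (by
    rw [← fockShift_expVec_zero (hξ.mem_ker x), h]; rfl)
  map_mul x y := ext_expVec fun η => by
    rw [mul_apply_eq_comp, fockShift_expVec (hξ.mem_ker _),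
      fockShift_expVec (hξ.mem_ker _), fockShift_expVec (hξ.mem_ker _), hξ.map_mul x y,
      _root_.map_mul V, map_add, add_assoc]
    rfl

theorem isAdditiveCocycle_zero : IsAdditiveCocycle V (0 : P → H) where
  continuous := continuous_const
  mem_ker _ := map_zero _
  map_mul _ _ := by simp

theorem hasMoreThanOneUnit_of_isAdditiveCocycle (hV : ∀ η, Continuous fun x => V x η)
    {ξ : P → H} (hξ : IsAdditiveCocycle V ξ) (h0 : ξ ≠ 0) : HasMoreThanOneUnit (ccrFlow V) := by
  refine ⟨_, _, isAdditiveCocycle_zero.isFlowUnit hV, hξ.isFlowUnit hV, fun χ _ => ?_⟩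
  by_contra! h
  refine h0 (funext fun x => ?_)
  have h1 : expVec (ξ x) = (χ x : ℂ) • expVec 0 := by
    have := congrArg (· (expVec 0)) (h x)
    simpa only [FunLike.coe_smul, Pi.smul_apply, fockShift_expVec_zero (hξ.mem_ker x),
      Pi.zero_apply, fockShift_expVec_zero (map_zero (V x).toContinuousLinearMap.adjoint)]
      using this
  have h2 := oneParticle_expVec (ξ x)
  rwa [h1, map_smul, oneParticle_expVec, smul_zero, eq_comm] at h2

end Units

/-! ### The isometric representation on `L²(A, μ)` -/

section Representation

theorem norm_sub_le_of_ae_restrict {α : Type*} [MeasurableSpace α] {μ : Measure α} {A : Set α}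
    {f g : Lp ℂ 2 (μ.restrict A)} {f' g' : Lp ℂ 2 μ}
    (h : ∀ᵐ y ∂μ.restrict A, ‖f y - g y‖ ≤ ‖f' y - g' y‖) : ‖f - g‖ ≤ ‖f' - g'‖ := by
  rw [Lp.norm_def, Lp.norm_def]
  refine ENNReal.toReal_mono (Lp.eLpNorm_ne_top _) ?_
  have h1 : ∀ᵐ y ∂μ.restrict A, ‖(f - g : Lp ℂ 2 (μ.restrict A)) y‖ ≤ ‖(f' - g' : Lp ℂ 2 μ) y‖ := by
    filter_upwards [h, Lp.coeFn_sub f g, ae_restrict_of_ae (Lp.coeFn_sub f' g')] with y h1 h2 h3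
    rw [h2, h3]
    exact h1
  exact (eLpNorm_mono_ae h1).trans (eLpNorm_mono_measure _ Measure.restrict_le_self)

variable {G : Type*} [Group G] [TopologicalSpace G] [IsTopologicalGroup G] [MeasurableSpace G]
  [BorelSpace G] {μ : Measure G} {P : Submonoid G} {A : Set G}

variable [μ.IsMulLeftInvariant]

theorem ae_restrict_comp_mul_left (hA : IsPSpace P A) {p : G → Prop}
    (h : ∀ᵐ z ∂μ.restrict A, p z) (x : P) : ∀ᵐ z ∂μ.restrict A, p (x * z) := by
  rw [ae_restrict_iff' hA.isClosed.measurableSet] at h ⊢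
  have h1 := (measurePreserving_mul_left μ (x : G)).quasiMeasurePreserving.ae h
  filter_upwards [h1] with z hz hzA
  exact hz (hA.mul_mem x x.2 z hzA)

theorem pSpaceRep_ae (hA : IsPSpace P A) (x : P) (f : Lp ℂ 2 (μ.restrict A)) :
    pSpaceRep μ hA x f =ᵐ[μ.restrict A] shiftFun A x f :=
  shiftIsometry_ae hA.isClosed.measurableSet (hA.mul_mem x x.2) f

/-- The kernel of `V_x*` consists of the functions which vanish on `x A`. -/
theorem adjoint_pSpaceRep_eq_zero_iff (hA : IsPSpace P A) (x : P) (f : Lp ℂ 2 (μ.restrict A)) :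
    (pSpaceRep μ hA x).toContinuousLinearMap.adjoint f = 0 ↔
      ∀ᵐ y ∂μ.restrict A, (x : G)⁻¹ * y ∈ A → f y = 0 := by
  classical
  have hm := hA.isClosed.measurableSet
  constructor
  · intro h
    -- The range of `V_x` contains the restriction of `f` to `x A`.
    have hg : MemLp (fun y => A.indicator f (x * y)) 2 (μ.restrict A) :=
      (((memLp_indicator_iff_restrict hm).2 (Lp.memLp f)).comp_measurePreserving
        (measurePreserving_mul_left μ (x : G))).restrict A
    set g := hg.toLp _
    have h1 : pSpaceRep μ hA x g =ᵐ[μ.restrict A] shiftFun A x (fun y => A.indicator f (x * y)) :=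
      (pSpaceRep_ae hA x g).trans (shiftFun_congr_ae hm x hg.coeFn_toLp)
    have h2 : ∀ᵐ y ∂μ.restrict A, pSpaceRep μ hA x g y = if (x : G)⁻¹ * y ∈ A then f y else 0 := by
      filter_upwards [h1, ae_restrict_mem hm] with y hy hyA
      rw [hy]
      simp [shiftFun, hyA]
    have h3 : ⟪pSpaceRep μ hA x g, pSpaceRep μ hA x g⟫_ℂ = ⟪f, pSpaceRep μ hA x g⟫_ℂ := by
      rw [L2.inner_def, L2.inner_def]
      refine integral_congr_ae ?_
      filter_upwards [h2] with y hy
      rw [hy]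
      split_ifs <;> simp
    have h4 : ⟪f, pSpaceRep μ hA x g⟫_ℂ = 0 := inner_isometry_eq_zero h g
    rw [h4, inner_self_eq_zero] at h3
    have h5 : pSpaceRep μ hA x g =ᵐ[μ.restrict A] 0 := by
      rw [h3]
      exact Lp.coeFn_zero _ _ _
    filter_upwards [h2, h5] with y hy hy' hyA
    rwa [hy', if_pos hyA, eq_comm] at hy
  · intro h
    refine ext_inner_right ℂ fun g => ?_
    rw [ContinuousLinearMap.adjoint_inner_left, inner_zero_left, L2.inner_def]
    refine integral_eq_zero_of_ae ?_
    filter_upwards [h, pSpaceRep_ae hA x g] with y hy hy'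
    change ⟪f y, pSpaceRep μ hA x g y⟫_ℂ = 0
    rw [hy']
    by_cases hyA : (x : G)⁻¹ * y ∈ A
    · rw [hy hyA, inner_zero_left]
    · simp [shiftFun, hyA]

variable [LocallyCompactSpace G] [SecondCountableTopology G] [IsFiniteMeasureOnCompacts μ]

/-- Left translations act strongly continuously on `L²(G, μ)`. -/
theorem exists_continuous_translate (F : Lp ℂ 2 μ) : ∃ T : G → Lp ℂ 2 μ, Continuous T ∧
    ∀ x, ∀ᵐ y ∂μ, T x y = F (x⁻¹ * y) := by
  refine ⟨fun x => DomMulAct.mk x⁻¹ • F, ?_, fun x => ?_⟩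
  · have : Fact ((2 : ENNReal) ≠ ⊤) := ⟨by simp⟩
    have h : Continuous fun x : G => DomMulAct.mk x⁻¹ :=
      DomMulAct.continuous_mk.comp continuous_inv
    exact h.smul continuous_const
  · filter_upwards [DomMulAct.smul_Lp_ae_eq (DomMulAct.mk x⁻¹) F] with y hy
    rw [hy]
    simp

theorem continuous_pSpaceRep_apply (hA : IsPSpace P A) (f : Lp ℂ 2 (μ.restrict A)) :
    Continuous fun x => pSpaceRep μ hA x f := by
  have hm := hA.isClosed.measurableSet
  have hF := (memLp_indicator_iff_restrict hm).2 (Lp.memLp f)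
  obtain ⟨T, hT, hTae⟩ := exists_continuous_translate (hF.toLp _)
  have h1 : ∀ x : P, ∀ᵐ y ∂μ.restrict A, pSpaceRep μ hA x f y = T x y := fun x => by
    have h2 := (measurePreserving_mul_left μ (x : G)⁻¹).quasiMeasurePreserving.ae hF.coeFn_toLp
    filter_upwards [pSpaceRep_ae hA x f, ae_restrict_of_ae (hTae x), ae_restrict_of_ae h2]
      with y hy hy' hy''
    rw [hy, hy', hy'', shiftFun_eq]
    rfl
  refine continuous_iff_continuousAt.2 fun x => tendsto_iff_norm_sub_tendsto_zero.2 ?_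
  have h2 := tendsto_iff_norm_sub_tendsto_zero.1 ((hT.comp continuous_subtype_val).tendsto x)
  refine squeeze_zero (fun _ => norm_nonneg _) (fun z => norm_sub_le_of_ae_restrict ?_) h2
  filter_upwards [h1 x, h1 z] with y hx hz
  rw [hx, hz]
  rfl

/-- If all the sets `A \ x A` have finite measure, their indicator functions form an additive
cocycle. Continuity at `x₀` follows from strong continuity of left translations: for `x` close to
`x₀`, the functions `1_{A \ x A} - 1_{A \ x₀ A}` vanish on `x₀ w A`, where `w` is an interior point of
`P`, and off this set they coincide with translates of the indicator function of `A \ w² A`. -/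
theorem IsPSpace.isAdditiveCocycle_indicator (hA : IsPSpace P A)
    (hPint : (P : Set G) ⊆ closure (interior (P : Set G))) (hfin : ∀ x ∈ P, μ (A \ x • A) < ⊤) :
    ∃ ξ : P → Lp ℂ 2 (μ.restrict A), IsAdditiveCocycle (pSpaceRep μ hA) ξ ∧
      ∀ x, ξ x =ᵐ[μ.restrict A] (A \ (x : G) • A).indicator fun _ => 1 := by
  classical
  have hm := hA.isClosed.measurableSet
  have hmx : ∀ x : G, MeasurableSet (A \ x • A) := fun x =>
    hm.diff (hA.isClosed.smul x).measurableSet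
  have hfin' : ∀ x ∈ P, μ.restrict A (A \ x • A) ≠ ⊤ := fun x hx =>
    ((Measure.restrict_apply_le _ _).trans_lt (hfin x hx)).ne
  set ξ : P → Lp ℂ 2 (μ.restrict A) := fun x =>
    indicatorConstLp 2 (hmx x) (hfin' x x.2) (1 : ℂ) with hξ
  have hae : ∀ x, ξ x =ᵐ[μ.restrict A] (A \ (x : G) • A).indicator fun _ => 1 := fun x =>
    indicatorConstLp_coeFn
  refine ⟨ξ, ⟨?_, fun x => ?_, fun x y => ?_⟩, hae⟩
  · obtain ⟨w, hw⟩ := interior_nonempty hPint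
    have hwP := interior_subset hw
    obtain ⟨T, hT, hTae⟩ := exists_continuous_translate
      (indicatorConstLp 2 (hmx (w * w)) (hfin _ (P.mul_mem hwP hwP)).ne (1 : ℂ))
    have hTae' : ∀ x, ∀ᵐ y ∂μ, T x y =
        (A \ (w * w) • A).indicator (fun _ => (1 : ℂ)) (x⁻¹ * y) := fun x => by
      have h2 := (measurePreserving_mul_left μ x⁻¹).quasiMeasurePreserving.ae
        (indicatorConstLp_coeFn (p := 2) (hs := hmx (w * w))
          (hμs := (hfin _ (P.mul_mem hwP hwP)).ne) (c := (1 : ℂ)))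
      filter_upwards [hTae x, h2] with y hy hy'
      rw [hy, hy']
    refine continuous_iff_continuousAt.2 fun x₀ => tendsto_iff_norm_sub_tendsto_zero.2 ?_
    have h2 := tendsto_iff_norm_sub_tendsto_zero.1 ((hT.comp continuous_subtype_val).tendsto x₀)
    refine squeeze_zero' (Filter.Eventually.of_forall fun _ => norm_nonneg _) ?_ h2
    have ho1 : ∀ᶠ x : P in 𝓝 x₀, (x : G)⁻¹ * (x₀ * w) ∈ interior (P : Set G) := by
      refine ContinuousAt.eventually_mem (f := fun x : P => (x : G)⁻¹ * (x₀ * w))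
        (by fun_prop) (isOpen_interior.mem_nhds ?_)
      simpa using hw
    have ho2 : ∀ᶠ x : P in 𝓝 x₀, ((x₀ : G) * w)⁻¹ * (x * (w * w)) ∈ interior (P : Set G) := by
      refine ContinuousAt.eventually_mem (f := fun x : P => ((x₀ : G) * w)⁻¹ * (x * (w * w)))
        (by fun_prop) (isOpen_interior.mem_nhds ?_)
      simpa [mul_assoc] using hw
    filter_upwards [ho1, ho2] with x hx1 hx2
    refine norm_sub_le_of_ae_restrict ?_
    filter_upwards [hae x, hae x₀, ae_restrict_of_ae (hTae' x), ae_restrict_of_ae (hTae' x₀),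
      ae_restrict_mem hm] with y e1 e2 e3 e4 hy
    rw [e1, e2, indicator_sdiff_smul_apply hy, indicator_sdiff_smul_apply hy, Function.comp_apply, Function.comp_apply, e3, e4]
    -- For `z` with `(x₀ w)⁻¹ z w² ∈ P`, off `x₀ w A` the function `1_{z A}` agrees with the translate
    -- of `1_{A \ w² A}` by `z`.
    have hoff : ∀ z : G, ((x₀ : G) * w)⁻¹ * (z * (w * w)) ∈ P → ((x₀ : G) * w)⁻¹ * y ∉ A →
        (A \ (w * w) • A).indicator (fun _ => (1 : ℂ)) (z⁻¹ * y) =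
          if z⁻¹ * y ∈ A then 1 else 0 := by
      intro z hz hyt
      have h3 : z⁻¹ * y ∉ (w * w) • A := fun h => by
        rw [mem_smul_iff] at h
        refine hyt ?_
        have := hA.mul_mem _ hz _ h
        convert! this using 1
        group
      by_cases h : z⁻¹ * y ∈ A
      · rw [if_pos h, Set.indicator_of_mem (Set.mem_sdiff_of_mem h h3)]
      · rw [if_neg h, Set.indicator_of_notMem fun h' => h h'.1]
    by_cases hyt : ((x₀ : G) * w)⁻¹ * y ∈ A
    · have h3 : (x : G)⁻¹ * y ∈ A := by
        have := hA.mul_mem _ (interior_subset hx1) _ hyt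
        convert! this using 1
        group
      have h4 : (x₀ : G)⁻¹ * y ∈ A := by
        have := hA.mul_mem _ hwP _ hyt
        convert! this using 1
        group
      simp [h3, h4]
    · rw [hoff x (interior_subset hx2) hyt, hoff x₀ (by simpa [mul_assoc] using hwP) hyt]
      split_ifs <;> simp
  · rw [adjoint_pSpaceRep_eq_zero_iff]
    filter_upwards [hae x, ae_restrict_mem hm] with y hy hyA h
    rw [hy, indicator_sdiff_smul_apply hyA, if_pos h]
  · refine Lp.ext ?_
    filter_upwards [hae (x * y), Lp.coeFn_add (ξ x) (pSpaceRep μ hA x (ξ y)), hae x,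
      pSpaceRep_ae hA x (ξ y), shiftFun_congr_ae hm (x : G) (hae y), ae_restrict_mem hm]
      with z h1 h2 h3 h4 h5 hz
    rw [h1, h2, Pi.add_apply, h3, h4, h5, indicator_sdiff_smul_apply hz, indicator_sdiff_smul_apply hz, shiftFun]
    have h6 : ((x * y : P) : G)⁻¹ * z = (y : G)⁻¹ * ((x : G)⁻¹ * z) := by
      rw [Submonoid.coe_mul]; group
    rw [h6]
    by_cases hxz : (x : G)⁻¹ * z ∈ A
    · rw [if_pos hxz, if_pos hxz, indicator_sdiff_smul_apply hxz, zero_add]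
    · have h7 : (y : G)⁻¹ * ((x : G)⁻¹ * z) ∉ A := fun h =>
        hxz (by simpa using hA.mul_mem y y.2 _ h)
      rw [if_neg hxz, if_neg hxz, if_neg h7, add_zero]

/-- The cocycle of indicator functions does not vanish: for an interior point `x` of `P`, the set
`A \ x A` contains a non-empty open set. -/
theorem IsPSpace.exists_isAdditiveCocycle_ne_zero [ConnectedSpace G] [μ.IsOpenPosMeasure]
    (hA : IsPSpace P A) (hPint : (P : Set G) ⊆ closure (interior (P : Set G)))
    (hfin : ∀ x ∈ P, μ (A \ x • A) < ⊤) :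
    ∃ ξ : P → Lp ℂ 2 (μ.restrict A), IsAdditiveCocycle (pSpaceRep μ hA) ξ ∧ ξ ≠ 0 := by
  obtain ⟨ξ, hξ, hae⟩ := hA.isAdditiveCocycle_indicator hPint hfin
  refine ⟨ξ, hξ, fun h0 => ?_⟩
  obtain ⟨x, hx⟩ := interior_nonempty hPint
  obtain ⟨U, hU, hUne, hsub⟩ := hA.exists_isOpen_mul_frontier_subset hPint hx
  have hpos : 0 < μ (U * frontier A) :=
    hU.mul_right.measure_pos μ (hUne.mul (nonempty_frontier_iff.2 ⟨hA.nonempty, hA.ne_univ⟩))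
  have h1 : ∀ᵐ y ∂μ, y ∉ A \ x • A := by
    have h2 := hae ⟨x, interior_subset hx⟩
    rw [h0] at h2
    have h3 : ∀ᵐ y ∂μ.restrict A, y ∉ A \ x • A := by
      filter_upwards [h2, Lp.coeFn_zero ℂ 2 (μ.restrict A)] with y h4 h5 hy
      rw [Pi.zero_apply, h5, Set.indicator_of_mem hy] at h4
      exact zero_ne_one h4
    rw [ae_restrict_iff' hA.isClosed.measurableSet] at h3
    filter_upwards [h3] with y hy hyA
    exact hy hyA.1 hyA
  have h2 := (frequently_ae_mem_iff.2 hpos.ne').and_eventually h1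
  obtain ⟨y, hy, hy'⟩ := h2.exists
  exact hy' (hsub hy)

end Representation

/-! ### Additive cocycles are multiples of indicator functions -/

section Rigidity

variable {G : Type*} [Group G] [TopologicalSpace G] [IsTopologicalGroup G] [MeasurableSpace G]
  [BorelSpace G] {μ : Measure G} {P : Submonoid G} {A : Set G}
  [SecondCountableTopology G]

/-- A measurable function on a set `A` which is invariant under `P` is constant. By Fubini's
theorem, for almost every `z ∈ A` it is almost everywhere equal to its value at `z` on the open set
`(interior P) z`, and any two such open sets intersect. -/
theorem exists_ae_eq_const_of_mul_invariant [SFinite μ] [μ.IsOpenPosMeasure]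
    [μ.IsMulRightInvariant] (hOre : IsOre P)
    (hPint : (P : Set G) ⊆ closure (interior (P : Set G))) {f : G → ℂ} (hf : StronglyMeasurable f)
    (hinv : ∀ x ∈ P, ∀ᵐ z ∂μ.restrict A, f (x * z) = f z) :
    ∃ c, ∀ᵐ z ∂μ.restrict A, f z = c := by
  have hmeas : MeasurableSet {q : G × G | f (q.1 * q.2) = f q.2} :=
    measurableSet_eq_fun (hf.measurable.comp measurable_mul) (hf.measurable.comp measurable_snd)
  have h1 : ∀ᵐ x ∂μ.restrict (interior (P : Set G)), ∀ᵐ z ∂μ.restrict A, f (x * z) = f z := by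
    filter_upwards [ae_restrict_mem isOpen_interior.measurableSet] with x hx
    exact hinv x (interior_subset hx)
  rw [Measure.ae_ae_comm (p := fun x z => f (x * z) = f z) hmeas] at h1
  have h2 : ∀ z, (∀ᵐ x ∂μ.restrict (interior (P : Set G)), f (x * z) = f z) →
      ∀ᵐ y ∂μ, y * z⁻¹ ∈ interior (P : Set G) → f y = f z := by
    intro z hz
    rw [ae_restrict_iff' isOpen_interior.measurableSet] at hz
    filter_upwards [(measurePreserving_mul_right μ z⁻¹).quasiMeasurePreserving.ae hz] with y hy hyz
    simpa using hy hyz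
  by_cases h0 : μ.restrict A = 0
  · exact ⟨0, by rw [h0]; simp⟩
  have : (ae (μ.restrict A)).NeBot := ae_neBot.2 h0
  obtain ⟨z₀, hz₀⟩ := h1.exists
  refine ⟨f z₀, ?_⟩
  filter_upwards [h1] with z hz
  obtain ⟨a, ha, b, hb, hab⟩ := hOre.exists_interior_inv_mul hPint (z * z₀⁻¹)
  have hopen : IsOpen {y : G | y * z⁻¹ ∈ interior (P : Set G) ∧ y * z₀⁻¹ ∈ interior (P : Set G)} :=
    (isOpen_interior.preimage (continuous_mul_const z⁻¹)).inter
      (isOpen_interior.preimage (continuous_mul_const z₀⁻¹))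
  have hne : (a * z) * z₀⁻¹ = b := by rw [mul_assoc, hab, mul_inv_cancel_left]
  have hpos : 0 < μ {y : G | y * z⁻¹ ∈ interior (P : Set G) ∧ y * z₀⁻¹ ∈ interior (P : Set G)} :=
    hopen.measure_pos μ ⟨a * z, by simpa using ha, by rw [hne]; exact hb⟩
  have hfreq := frequently_ae_mem_iff.2 hpos.ne'
  obtain ⟨y, ⟨hy, hy₀⟩, h3, h4⟩ := (hfreq.and_eventually ((h2 z hz).and (h2 z₀ hz₀))).exists
  rw [← h3 hy, h4 hy₀]

variable [μ.IsMulLeftInvariant]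

/-- The members `ξ_x` of an additive cocycle, which are supported on `A \ x A`, are restrictions of
one function on `A`. -/
theorem IsAdditiveCocycle.exists_stronglyMeasurable {hA : IsPSpace P A} (hOre : IsOre P)
    {ξ : P → Lp ℂ 2 (μ.restrict A)} (hξ : IsAdditiveCocycle (pSpaceRep μ hA) ξ) :
    ∃ f : G → ℂ, StronglyMeasurable f ∧
      ∀ x : P, ∀ᵐ z ∂μ.restrict A, (x : G)⁻¹ * z ∉ A → f z = ξ x z := by
  have hm := hA.isClosed.measurableSet
  have hmul : ∀ x y : P, ∀ᵐ z ∂μ.restrict A, (x : G)⁻¹ * z ∉ A → ξ (x * y) z = ξ x z := by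
    intro x y
    rw [hξ.map_mul]
    filter_upwards [Lp.coeFn_add (ξ x) (pSpaceRep μ hA x (ξ y)), pSpaceRep_ae hA x (ξ y)]
      with z h1 h2 hz
    rw [h1, Pi.add_apply, h2, shiftFun, if_neg hz, add_zero]
  have hcons : ∀ x y : P, ∀ᵐ z ∂μ.restrict A, (x : G)⁻¹ * z ∉ A → (y : G)⁻¹ * z ∉ A →
      ξ x z = ξ y z := by
    intro x y
    obtain ⟨a, ha, b, hb, hab⟩ := hOre.exists_mul_inv ((x : G)⁻¹ * y)
    have h : x * ⟨a, ha⟩ = y * ⟨b, hb⟩ := Subtype.ext (by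
      have h' : a = (x : G)⁻¹ * y * b := by rw [hab]; group
      change (x : G) * a = y * b
      rw [h']
      group)
    filter_upwards [hmul x ⟨a, ha⟩, hmul y ⟨b, hb⟩] with z h1 h2 hx hy
    rw [← h1 hx, ← h2 hy, h]
  classical
  obtain ⟨d, hex⟩ := hA.exists_seq_inv_mul_notMem hOre
  set f : G → ℂ := fun z => ξ (d (Nat.find (hex z))) z
  have hf : ∀ x : P, ∀ᵐ z ∂μ.restrict A, (x : G)⁻¹ * z ∉ A → f z = ξ x z := by
    intro x
    filter_upwards [ae_all_iff.2 fun n => hcons (d n) x] with z hz hxz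
    exact hz _ (Nat.find_spec (hex z)) hxz
  have hfm : AEStronglyMeasurable f (μ.restrict A) := by
    set B : ℕ → Set G := fun n =>
      (fun z => (d n : G)⁻¹ * z) ⁻¹' Aᶜ with hB
    have hBm : ∀ n, MeasurableSet (B n) := fun n => by
      have : IsOpen (B n) := hA.isClosed.isOpen_compl.preimage (by fun_prop)
      exact this.measurableSet
    have hcover : (⋃ n, B n) = Set.univ :=
      Set.eq_univ_of_forall fun z => Set.mem_iUnion.2 (hex z)
    rw [← Measure.restrict_univ (μ := μ.restrict A), ← hcover, aestronglyMeasurable_iUnion_iff]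
    intro n
    refine ((Lp.aestronglyMeasurable (ξ (d n))).mono_measure
      Measure.restrict_le_self).congr ?_
    filter_upwards [ae_restrict_of_ae (hf (d n)),
      ae_restrict_mem (hBm n)] with z hz hzB
    exact (hz hzB).symm
  refine ⟨hfm.mk f, hfm.stronglyMeasurable_mk, fun x => ?_⟩
  filter_upwards [hf x, hfm.ae_eq_mk] with z h1 h2 hz
  rw [← h2, h1 hz]

/-- Every additive cocycle is of the form `ξ_x = c 1_{A \ x A}`. -/
theorem IsAdditiveCocycle.exists_ae_eq_const [SFinite μ] [μ.IsOpenPosMeasure]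
    [μ.IsMulRightInvariant] {hA : IsPSpace P A} (hOre : IsOre P)
    (hPint : (P : Set G) ⊆ closure (interior (P : Set G)))
    {ξ : P → Lp ℂ 2 (μ.restrict A)} (hξ : IsAdditiveCocycle (pSpaceRep μ hA) ξ) :
    ∃ c : ℂ, ∀ x : P, ξ x =ᵐ[μ.restrict A] (A \ (x : G) • A).indicator fun _ => c := by
  have hm := hA.isClosed.measurableSet
  obtain ⟨f, hf, hfξ⟩ := hξ.exists_stronglyMeasurable hOre
  have hker : ∀ x : P, ∀ᵐ z ∂μ.restrict A, (x : G)⁻¹ * z ∈ A → ξ x z = 0 := fun x =>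
    (adjoint_pSpaceRep_eq_zero_iff hA x (ξ x)).1 (hξ.mem_ker x)
  obtain ⟨d, hd⟩ := hA.exists_seq_inv_mul_notMem hOre
  have hinv : ∀ x ∈ P, ∀ᵐ z ∂μ.restrict A, f (x * z) = f z := by
    intro x hx
    have h1 : ∀ n, ∀ᵐ z ∂μ.restrict A, (d n : G)⁻¹ * z ∉ A →
        f (x * z) = f z := by
      intro n
      have h2 : ∀ᵐ z ∂μ.restrict A, ξ (⟨x, hx⟩ * d n) z = ξ ⟨x, hx⟩ z + shiftFun A x (ξ (d n)) z := by
        rw [hξ.map_mul]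
        filter_upwards [Lp.coeFn_add (ξ ⟨x, hx⟩) (pSpaceRep μ hA ⟨x, hx⟩ (ξ (d n))),
          pSpaceRep_ae hA ⟨x, hx⟩ (ξ (d n))] with z h1 h2
        rw [h1, Pi.add_apply, h2]
      filter_upwards [hfξ (d n), ae_restrict_comp_mul_left hA h2 ⟨x, hx⟩,
        ae_restrict_comp_mul_left hA (hfξ (⟨x, hx⟩ * d n)) ⟨x, hx⟩,
        ae_restrict_comp_mul_left hA (hker ⟨x, hx⟩) ⟨x, hx⟩, ae_restrict_mem hm]
        with z e1 e2 e3 e4 hz hzd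
      have h3 : ((⟨x, hx⟩ * d n : P) : G)⁻¹ * (x * z) ∉ A := by
        rw [Submonoid.coe_mul]
        simpa [mul_assoc] using hzd
      rw [e1 hzd, e3 h3, e2, e4 (by simpa using hz), zero_add, shiftFun]
      simp [hz]
    filter_upwards [ae_all_iff.2 h1] with z hz
    obtain ⟨n, hn⟩ := hd z
    exact hz n hn
  obtain ⟨c, hc⟩ := exists_ae_eq_const_of_mul_invariant hOre hPint hf hinv
  refine ⟨c, fun x => ?_⟩
  filter_upwards [hc, hfξ x, hker x, ae_restrict_mem hm] with z h1 h2 h3 hz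
  by_cases h : (x : G)⁻¹ * z ∈ A
  · rw [h3 h, indicator_sdiff_smul_apply hz, if_pos h]
  · rw [indicator_sdiff_smul_apply hz, if_neg h, ← h2 h, h1]

theorem IsAdditiveCocycle.measure_sdiff_lt_top [SFinite μ] [μ.IsOpenPosMeasure]
    [μ.IsMulRightInvariant] {hA : IsPSpace P A} (hOre : IsOre P)
    (hPint : (P : Set G) ⊆ closure (interior (P : Set G)))
    {ξ : P → Lp ℂ 2 (μ.restrict A)} (hξ : IsAdditiveCocycle (pSpaceRep μ hA) ξ) (h0 : ξ ≠ 0) :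
    ∀ x ∈ P, μ (A \ x • A) < ⊤ := by
  obtain ⟨c, hc⟩ := hξ.exists_ae_eq_const hOre hPint
  have hc0 : c ≠ 0 := by
    rintro rfl
    refine h0 (funext fun x => Lp.ext ((hc x).trans ?_))
    filter_upwards [Lp.coeFn_zero ℂ 2 (μ.restrict A)] with z hz
    rw [Pi.zero_apply, hz]
    simp
  intro x hx
  have hmx : MeasurableSet (A \ x • A) :=
    hA.isClosed.measurableSet.diff (hA.isClosed.smul x).measurableSet
  have h1 : MemLp ((A \ x • A).indicator fun _ => c) 2 (μ.restrict A) :=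
    (memLp_congr_ae (hc ⟨x, hx⟩)).1 (Lp.memLp (ξ ⟨x, hx⟩))
  rw [memLp_indicator_iff_restrict hmx, memLp_const_iff (by simp) (by simp)] at h1
  have h2 := h1.resolve_left hc0
  rwa [Measure.restrict_apply_univ, Measure.restrict_apply hmx,
    Set.inter_eq_left.2 Set.sdiff_subset] at h2

end Rigidity

end PSpaceCCR

theorem mainTheorem6
    {E : Type*} [NormedAddCommGroup E] [NormedSpace ℝ E] [FiniteDimensional ℝ E]
    {G : Type*} [Group G] [TopologicalSpace G] [ChartedSpace E G] [LieGroup 𝓘(ℝ, E) ∞ G]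
    [IsTopologicalGroup G] [T2Space G] [ConnectedSpace G] [MeasurableSpace G] [BorelSpace G]
    (μ : Measure G) [μ.IsHaarMeasure] [μ.IsMulRightInvariant]
    (P : Submonoid G) (hP : IsLieSemigroup E P)
    (hPint : (P : Set G) ⊆ closure (interior (P : Set G))) (hOre : IsOre P)
    (A : Set G) (hA : IsPSpace P A) :
    [∀ x ∈ P, μ (A \ x • A) < ⊤,
      ∀ x ∈ interior (P : Set G), μ (A \ x • A) < ⊤,
      IsCompact (frontier A)].TFAE ∧
    ((∃ ξ : P → Lp ℂ 2 (μ.restrict A), IsAdditiveCocycle (pSpaceRep μ hA) ξ ∧ ξ ≠ 0) ↔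
      IsCompact (frontier A)) ∧
    (HasMoreThanOneUnit (ccrFlow (pSpaceRep μ hA)) ↔ IsCompact (frontier A)) := by
  have : LocallyCompactSpace G := ChartedSpace.locallyCompactSpace E G
  have : SigmaCompactSpace G := sigmaCompactSpace_of_connected
  have : SecondCountableTopology G := ChartedSpace.secondCountable_of_sigmaCompact E G
  have htfae := hA.tfae_isCompact_frontier hP hPint μ
  have h13 : (∀ x ∈ P, μ (A \ x • A) < ⊤) ↔ IsCompact (frontier A) := htfae.out 0 2
  have h1 : (∃ ξ : P → Lp ℂ 2 (μ.restrict A), IsAdditiveCocycle (pSpaceRep μ hA) ξ ∧ ξ ≠ 0) ↔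
      IsCompact (frontier A) := by
    rw [← h13]
    exact ⟨fun ⟨ξ, hξ, h0⟩ => hξ.measure_sdiff_lt_top hOre hPint h0,
      hA.exists_isAdditiveCocycle_ne_zero hPint⟩
  refine ⟨htfae, h1, ?_⟩
  rw [← h1]
  exact ⟨exists_isAdditiveCocycle_of_hasMoreThanOneUnit hP hPint hOre, fun ⟨ξ, hξ, h0⟩ =>
    hasMoreThanOneUnit_of_isAdditiveCocycle (continuous_pSpaceRep_apply hA) hξ h0⟩
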